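/- Let $(k,|\cdot|)$ be an algebraically closed field of characteristic $0$, complete with respect to a (possibly trivial) ultrametric absolute value, and let $(\Omega,|\cdot|)$ be a complete valued field extension of $k$ (the absolute value of $\Omega$ is ultrametric and extends that of $k$). Let $\Omega^{alg}$ be an algebraic closure of $\Omega$ with the absolute value extending that of $\Omega$, and let $\widehat{\Omega^{alg}}$ be its completion. Let $d:\Omega\to\Omega$ be a bounded $k$-derivation, with operator norm $\|d\|=\inf\{C\ge 0:\ |d(f)|\le C|f|\ \text{for all } f\in\Omega\}<\infty$, and let $\mathscr{D}_\Omega=\bigoplus_{i\ge 0}\Omega\cdot d^i$ be the ring of differential polynomials, with multiplication determined by $d\cdot f=d(f)+f\cdot d$ for $f\in\Omega$. For $P(T)=\sum_i a_iT^i\in\Omega[T]$ write $P(d)=\sum_i a_i d^i\in\mathscr{D}_\Omega$. Let $\mathbb{A}^{1,an}_k$ be the Berkovich affine line, i.e. the set of multiplicative seminorms $Q\mapsto|Q(x)|$ on $k[T]$ extending $|\cdot|$ on $k$, let $r_k(x)=\inf_{c\in k}|T(x)-c|$ be the radius of a point $x$, and let $\pi:\mathbb{A}^{1,an}_{\widehat{\Omega^{alg}}}\to\mathbb{A}^{1,an}_k$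 be the canonical projection (restriction of seminorms). An element $z\in\Omega^{alg}$ is regarded as a point of $\mathbb{A}^{1,an}_{\widehat{\Omega^{alg}}}$, so that $\pi(z)$ is the seminorm $Q\mapsto|Q(z)|$ on $k[T]$. **Theorem.** Let $P(T)\in\Omega[T]$ be monic, and let $\{z_1,\dots,z_n\}\subset\Omega^{alg}$ be the multiset of roots of the commutative polynomial $P(T)$. Assume that $r_k(\pi(z_i))>\|d\|$ for every $i$. Write $\pi(\{z_1,\dots,z_n\})=\{\omega_1,\dots,\omega_\nu\}$ with $\omega_i\neq\omega_j$ for $i\ne j$ and $r_k(\omega_1)\le\dots\le r_k(\omega_\nu)$. Then there exist monic polynomials $P_{\omega_1}(T),\dots,P_{\omega_\nu}(T)\in\Omega[T]$ such that for each $i$ the image under $\pi$ of the set of roots of $P_{\omega_i}(T)$ in $\Omega^{alg}$ is exactly $\{\omega_i\}$, and $$P(d)=P_{\omega_\nu}(d)\cdots P_{\omega_1}(d)\quad\text{in } \mathscr{D}_\Omega .$$ -/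

import Mathlib

open Polynomial

noncomputable section

/-! ### Points of the Berkovich affine line -/

/-- The underlying set of the analytic affine line `𝔸¹` over a normed field `K` in the sense of
Berkovich: the multiplicative seminorms on `K[T]` that extend the absolute value of `K`. -/
structure BerkovichLine (K : Type*) [NormedField K] where
  /-- the multiplicative seminorm `Q ↦ |Q(x)|` -/
  seminorm : MulRingSeminorm K[X]
  map_const : ∀ a : K, seminorm (C a) = ‖a‖

namespace BerkovichLine

/-- The rigid point `Q ↦ |Q(z)|` of the line over `K` defined by an element `z` of `K`. -/
def rigid {K : Type*} [NormedField K] (z : K) : BerkovichLine K where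
  seminorm :=
    { toFun := fun Q => ‖Q.eval z‖
      map_zero' := by simp
      add_le' := fun Q R => by simpa using norm_add_le (Q.eval z) (R.eval z)
      neg' := fun Q => by simp
      map_one' := by simp
      map_mul' := fun Q R => by simp }
  map_const := fun a => by
    change ‖(C a).eval z‖ = ‖a‖
    simp

/-- The canonical projection from the line over an extension `K` of `k` to the line over `k`:
restriction of seminorms along `k[T] → K[T]`. -/
def proj (k : Type*) {K : Type*} [NormedField k] [NormedField K] [NormedAlgebra k K]
    (x : BerkovichLine K) : BerkovichLine k where
  seminorm :=
    { toFun := fun Q => x.seminorm (Q.map (algebraMap k K))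
      map_zero' := by simp
      add_le' := fun Q R => by
        simpa using map_add_le_add x.seminorm (Q.map (algebraMap k K)) (R.map (algebraMap k K))
      neg' := fun Q => by simp [map_neg_eq_map]
      map_one' := by simp
      map_mul' := fun Q R => by simp }
  map_const := fun a => by
    change x.seminorm ((C a).map (algebraMap k K)) = ‖a‖
    rw [Polynomial.map_C, x.map_const, norm_algebraMap']

/-- The radius `r_k(x) = inf_{c ∈ k} |T(x) - c|` of a point of the line over an algebraically
closed field `k`. -/
def radius {k : Type*} [NormedField k] [IsAlgClosed k] (x : BerkovichLine k) : ℝ :=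
  ⨅ c : k, x.seminorm (X - C c)

/-- The projection to the line over `k` of an element `z` of a valued extension `L` of `k` (in
practice an algebraic closure): the image of the rigid point `z` of the line over the completion
of `L`. -/
def ofElement (k : Type*) {L : Type*} [NormedField k] [NormedField L] [NormedAlgebra k L]
    (z : L) : BerkovichLine k :=
  proj k (rigid (z : UniformSpace.Completion L))

theorem ofElement_apply (k : Type*) {L : Type*} [NormedField k] [NormedField L]
    [NormedAlgebra k L] (z : L) (Q : k[X]) : (ofElement k z).seminorm Q = ‖aeval z Q‖ := by
  have h : (algebraMap k (UniformSpace.Completion L)) =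
      (UniformSpace.Completion.coeRingHom : L →+* UniformSpace.Completion L).comp
        (algebraMap k L) := rfl
  change ‖(Q.map (algebraMap k (UniformSpace.Completion L))).eval
    (UniformSpace.Completion.coeRingHom z)‖ = ‖aeval z Q‖
  rw [h, ← Polynomial.map_map, Polynomial.eval_map_apply, Polynomial.eval_map_algebraMap]
  exact UniformSpace.Completion.norm_coe _

end BerkovichLine

/-! ### Bounded derivations -/

section Derivations

variable {k Ω : Type*} [NormedField k] [NormedField Ω] [NormedAlgebra k Ω]

/-- A `k`-derivation of `Ω` is bounded if `|d f| ≤ C |f|` for some constant `C`.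
(If `k` is trivially valued, this is stronger than continuity.) -/
def Derivation.IsBounded (d : Derivation k Ω Ω) : Prop :=
  ∃ B : ℝ, ∀ f : Ω, ‖d f‖ ≤ B * ‖f‖

/-- The operator norm of a bounded derivation. -/
def Derivation.operatorNorm (d : Derivation k Ω Ω) : ℝ :=
  sInf {B : ℝ | 0 ≤ B ∧ ∀ f : Ω, ‖d f‖ ≤ B * ‖f‖}

end Derivations

/-! ### The ring of differential polynomials -/

section DifferentialPolynomials

variable {k K : Type*} [Field k] [Field K] [Algebra k K]

/-- The underlying left `K`-vector space `⨁ i, K · dⁱ` of the ring of differential polynomials;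
the differential polynomial `∑ aᵢ dⁱ` is stored as the polynomial `∑ aᵢ Tⁱ`. -/
def DiffPoly (_d : Derivation k K K) : Type _ := K[X]

namespace DiffPoly

variable (d : Derivation k K K)

instance : AddCommGroup (DiffPoly d) := inferInstanceAs (AddCommGroup K[X])

/-- Left multiplication by `d`, `∑ bⱼ dʲ ↦ ∑ bⱼ dʲ⁺¹ + ∑ d(bⱼ) dʲ`, on coefficient sequences. -/
def dMul : K[X] →ₗ[k] K[X] :=
  LinearMap.mulLeft k (X : K[X]) +
    Polynomial.lsum fun j => ((monomial j : K →ₗ[K] K[X]).restrictScalars k) ∘ₗ (d : K →ₗ[k] K)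

/-- The product `(∑ aᵢ dⁱ) · Q = ∑ aᵢ (dⁱ · Q)`, on coefficient sequences. -/
def mulAux (P Q : K[X]) : K[X] := P.sum fun i a => C a * (dMul d ^ i) Q

variable {d}

theorem dMul_monomial (j : ℕ) (b : K) :
    dMul d (monomial j b) = monomial (j + 1) b + monomial j (d b) := by
  simp [dMul, Polynomial.lsum_apply, X_mul_monomial, Polynomial.sum_monomial_index]

theorem dMul_C_mul (a : K) (Q : K[X]) : dMul d (C a * Q) = C a * dMul d Q + C (d a) * Q := by
  induction Q using Polynomial.induction_on' with
  | add p q hp hq => simp only [mul_add, map_add, hp, hq]; ring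
  | monomial n b =>
    simp only [C_mul_monomial, dMul_monomial, Derivation.leibniz, smul_eq_mul, mul_add, map_add]
    rw [mul_comm b (d a)]
    ring

theorem mulAux_add_left (P P' Q : K[X]) : mulAux d (P + P') Q = mulAux d P Q + mulAux d P' Q :=
  Polynomial.sum_add_index _ _ _ (by simp) (by intros; simp [add_mul])

theorem mulAux_add_right (P Q Q' : K[X]) : mulAux d P (Q + Q') = mulAux d P Q + mulAux d P Q' := by
  simp only [mulAux, map_add, mul_add, Polynomial.sum_add]

theorem mulAux_zero (P : K[X]) : mulAux d P 0 = 0 := by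
  simp [mulAux, Polynomial.sum_def]

theorem zero_mulAux (Q : K[X]) : mulAux d 0 Q = 0 := by
  simp [mulAux]

theorem mulAux_monomial (i : ℕ) (a : K) (Q : K[X]) :
    mulAux d (monomial i a) Q = C a * (dMul d ^ i) Q :=
  Polynomial.sum_monomial_index _ _ (by simp)

theorem mulAux_C_mul (a : K) (P Q : K[X]) : mulAux d (C a * P) Q = C a * mulAux d P Q := by
  induction P using Polynomial.induction_on' with
  | add p q hp hq => simp only [mul_add, mulAux_add_left, hp, hq]
  | monomial n b => simp only [C_mul_monomial, mulAux_monomial, C_mul, mul_assoc]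

theorem mulAux_dMul (P Q : K[X]) : mulAux d (dMul d P) Q = dMul d (mulAux d P Q) := by
  induction P using Polynomial.induction_on' with
  | add p q hp hq => simp only [map_add, mulAux_add_left, hp, hq]
  | monomial n b =>
    simp only [dMul_monomial, mulAux_add_left, mulAux_monomial, dMul_C_mul, pow_succ',
      Module.End.mul_apply]

theorem mulAux_dMul_pow (i : ℕ) (P Q : K[X]) :
    mulAux d ((dMul d ^ i) P) Q = (dMul d ^ i) (mulAux d P Q) := by
  induction i with
  | zero => simp
  | succ n ih => simp only [pow_succ', Module.End.mul_apply, mulAux_dMul, ih]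

theorem mulAux_assoc (P Q R : K[X]) :
    mulAux d (mulAux d P Q) R = mulAux d P (mulAux d Q R) := by
  induction P using Polynomial.induction_on' with
  | add p q hp hq => simp only [mulAux_add_left, hp, hq]
  | monomial n b => simp only [mulAux_monomial, mulAux_C_mul, mulAux_dMul_pow]

theorem one_mulAux (Q : K[X]) : mulAux d 1 Q = Q := by
  have h := mulAux_monomial (d := d) 0 1 Q
  simpa using h

theorem dMul_pow_one (i : ℕ) : (dMul d ^ i) (1 : K[X]) = monomial i 1 := by
  induction i with
  | zero => simp
  | succ n ih => rw [pow_succ', Module.End.mul_apply, ih, dMul_monomial]; simp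

theorem mulAux_one (P : K[X]) : mulAux d P 1 = P := by
  induction P using Polynomial.induction_on' with
  | add p q hp hq => simp only [mulAux_add_left, hp, hq]
  | monomial n b => simp [mulAux_monomial, dMul_pow_one, C_mul_monomial]

/-- The ring `𝒟_{K,d}` of differential polynomials, with `d · f = d(f) + f · d`. -/
instance : Ring (DiffPoly d) :=
  { (inferInstance : AddCommGroup (DiffPoly d)) with
    mul := fun P Q => mulAux d P Q
    one := (1 : K[X])
    left_distrib := fun P Q R => mulAux_add_right (d := d) P Q R
    right_distrib := fun P Q R => mulAux_add_left (d := d) P Q R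
    zero_mul := fun Q => zero_mulAux (d := d) Q
    mul_zero := fun P => mulAux_zero (d := d) P
    mul_assoc := fun P Q R => mulAux_assoc (d := d) P Q R
    one_mul := fun Q => one_mulAux (d := d) Q
    mul_one := fun P => mulAux_one (d := d) P }

variable (d)

/-- The differential polynomial `P(d) = ∑ aᵢ dⁱ` attached to `P(T) = ∑ aᵢ Tⁱ`. -/
def ofPoly : K[X] ≃+ DiffPoly d  where
  toFun P := P
  invFun P := P
  left_inv _ := rfl
  right_inv _ := rfl
  map_add' _ _ := rfl

theorem ofPoly_X_mul_C (f : K) :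
    ofPoly d X * ofPoly d (C f) = ofPoly d (C (d f)) + ofPoly d (C f) * ofPoly d X := by
  change mulAux d X (C f) = C (d f) + mulAux d (C f) X
  rw [← monomial_one_one_eq_X, ← monomial_zero_left (a := f), mulAux_monomial, mulAux_monomial,
    pow_one, dMul_monomial]
  simp [add_comm, C_mul_monomial]

theorem ofPoly_eq_sum (P : K[X]) :
    ofPoly d P = ∑ i ∈ P.support, ofPoly d (C (P.coeff i)) * ofPoly d X ^ i := by
  have hX : ∀ i : ℕ, ofPoly d X ^ i = ofPoly d (monomial i 1) := by
    intro i
    induction i with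
    | zero =>
      rw [pow_zero, monomial_zero_left, C_1]
      rfl
    | succ n ih =>
      rw [pow_succ', ih]
      change mulAux d X (monomial n 1) = monomial (n + 1) 1
      rw [← monomial_one_one_eq_X, mulAux_monomial, pow_one, dMul_monomial]
      simp
  have hm : ∀ (i : ℕ) (a : K),
      ofPoly d (C a) * ofPoly d (monomial i 1) = ofPoly d (monomial i a) := by
    intro i a
    change mulAux d (C a) (monomial i 1) = monomial i a
    rw [← monomial_zero_left (a := a), mulAux_monomial]
    simp [C_mul_monomial]
  simp only [hX, hm]
  conv_lhs => rw [P.as_sum_support]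
  exact map_sum (ofPoly d) _ _

end DiffPoly

end DifferentialPolynomials

end

/-! For `r > ‖d‖`, the product of `𝒟_Ω`, read on coefficient sequences, is a small deformation of
the commutative one. Applying `d` to coefficients costs a factor `‖d‖` where multiplying by `T`
costs `r`, so in Gauss norm of radius `r` the two products differ by a relative factor at most `‖d‖
/ r < 1` (`DiffPoly.isProductDeformation`). Since `d` kills `k`, the translations `T ↦ T + c` with
`c ∈ k` respect both products (`DiffPoly.taylor_mulHom`), so the comparison holds around every
centre in `k`.

This has two consequences. If no root of `P` is at distance exactly `r` from `c`, the Gauss norm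
around `c` is attained at a single term, whose index counts the roots in the disc. Hensel iteration
for the deformed product then separates the roots inside from the roots outside, with the two
factors in either order (`DiffPoly.exists_factorization_disc`). Moreover dominant indices add, so
root counts in discs are additive (`DiffPoly.rootCount_mulHom`).

As `k` is algebraically closed, a point of the line is determined by its distances to elements of
`k`, so discs separate points; the assumption on radii lets one use only discs of radius greater
than `‖d‖`. Counting shows that the root points of a product are the union of those of its factors
(`DiffPoly.rootPoints_mulHom`), and repeated splitting isolates any chosen point in a left factor
(`DiffPoly.exists_left_factor`). Peeling off `ω_ν`, then `ω_{ν-1}`, and so on, gives the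
factorization. -/

noncomputable section

/-! ### Bounds for the coefficients of polynomials at a radius -/

section Bounds

variable {K : Type*} [NormedField K]

/-- The Gauss norm of radius `r` of `P` is at most `C`. -/
def GaussBound (r : ℝ) (P : K[X]) (C : ℝ) : Prop := ∀ i, ‖P.coeff i‖ * r ^ i ≤ C

/-- The Gauss norm of radius `r` of `P` is attained exactly at the term of index `a`. -/
def GaussDominant (r : ℝ) (P : K[X]) (a : ℕ) : Prop :=
  ∀ i, i ≠ a → ‖P.coeff i‖ * r ^ i < ‖P.coeff a‖ * r ^ a

namespace GaussBound

variable {r : ℝ} {P Q : K[X]} {C D : ℝ}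

theorem mono (h : GaussBound r P C) (hCD : C ≤ D) : GaussBound r P D :=
  fun i => (h i).trans hCD

theorem nonneg (h : GaussBound r P C) : 0 ≤ C :=
  le_trans (by simp) (h 0)

theorem zero (hC : 0 ≤ C) : GaussBound r (0 : K[X]) C := fun i => by simpa using hC

theorem neg (h : GaussBound r P C) : GaussBound r (-P) C := fun i => by
  simpa using h i

theorem monomial (i : ℕ) {a : K} (hC : 0 ≤ C) (h : ‖a‖ * r ^ i ≤ C) :
    GaussBound r (monomial i a) C := fun j => by
  rw [coeff_monomial]
  split_ifs with hij
  · exact hij ▸ h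
  · simpa using hC

variable [IsUltrametricDist K]

theorem add (hr : 0 ≤ r) (hP : GaussBound r P C) (hQ : GaussBound r Q C) :
    GaussBound r (P + Q) C := fun i => by
  rw [coeff_add]
  rcases le_total ‖P.coeff i‖ ‖Q.coeff i‖ with h | h
  · refine le_trans ?_ (hQ i)
    gcongr
    exact (IsUltrametricDist.norm_add_le_max _ _).trans (max_le h le_rfl)
  · refine le_trans ?_ (hP i)
    gcongr
    exact (IsUltrametricDist.norm_add_le_max _ _).trans (max_le le_rfl h)

theorem sub (hr : 0 ≤ r) (hP : GaussBound r P C) (hQ : GaussBound r Q C) :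
    GaussBound r (P - Q) C := by
  rw [sub_eq_add_neg]
  exact hP.add hr hQ.neg

theorem sum {ι : Type*} (hr : 0 ≤ r) (hC : 0 ≤ C) (s : Finset ι) (f : ι → K[X])
    (h : ∀ i ∈ s, GaussBound r (f i) C) : GaussBound r (∑ i ∈ s, f i) C :=
  Finset.sum_induction f (GaussBound r · C) (fun _ _ => add hr) (zero hC) h

omit [IsUltrametricDist K] in
theorem monomial_mul (hr : 0 ≤ r) (i : ℕ) {a : K} (h : ‖a‖ * r ^ i ≤ C) (hQ : GaussBound r Q D) :
    GaussBound r (Polynomial.monomial i a * Q) (C * D) := fun j => by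
  have hC : 0 ≤ C := le_trans (by positivity) h
  rw [← C_mul_X_pow_eq_monomial, mul_assoc, coeff_C_mul, coeff_X_pow_mul']
  split_ifs with hij
  · obtain ⟨l, rfl⟩ := Nat.exists_eq_add_of_le hij
    rw [Nat.add_sub_cancel_left, norm_mul, pow_add]
    calc ‖a‖ * ‖Q.coeff l‖ * (r ^ i * r ^ l) = (‖a‖ * r ^ i) * (‖Q.coeff l‖ * r ^ l) := by ring
      _ ≤ C * D := mul_le_mul h (hQ l) (by positivity) hC
  · simpa using mul_nonneg hC (hQ.nonneg)

theorem mul (hr : 0 ≤ r) (hP : GaussBound r P C) (hQ : GaussBound r Q D) :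
    GaussBound r (P * Q) (C * D) := by
  conv_lhs => rw [P.as_sum_support]
  rw [Finset.sum_mul]
  exact sum hr (mul_nonneg (hP.nonneg) (hQ.nonneg)) _ _
    fun i _ => monomial_mul hr i (hP i) hQ

end GaussBound

theorem eq_zero_of_forall_gaussBound {r : ℝ} (hr : 0 < r) {P : K[X]} {C η : ℝ} (hη : 0 ≤ η)
    (hη1 : η < 1) (h : ∀ n : ℕ, GaussBound r P (C * η ^ n)) : P = 0 := by
  ext i
  have ht : Filter.Tendsto (fun n : ℕ => C * η ^ n) Filter.atTop (nhds (C * 0)) :=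
    (tendsto_pow_atTop_nhds_zero_of_lt_one hη hη1).const_mul C
  have h0 : ‖P.coeff i‖ * r ^ i ≤ C * 0 := ge_of_tendsto' ht fun n => h n i
  rw [mul_zero] at h0
  rw [coeff_zero, ← norm_le_zero_iff]
  by_contra hc
  have : 0 < r ^ i := by positivity
  nlinarith

namespace GaussDominant

variable {r : ℝ} {P Q : K[X]} {a b : ℕ}

theorem gaussBound (h : GaussDominant r P a) : GaussBound r P (‖P.coeff a‖ * r ^ a) := fun i => by
  rcases eq_or_ne i a with rfl | hi
  · exact le_rfl
  · exact (h i hi).le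

theorem index_unique (h : GaussDominant r P a) (h' : GaussDominant r P b) : a = b := by
  by_contra hab
  exact lt_asymm (h b (Ne.symm hab)) (h' a hab)

/-- Only the finitely many indices of the support matter, so strict dominance is uniform. The ratio
`δ` later enters the contraction rate of the Hensel iteration. -/
theorem exists_ratio (hr : 0 < r) (h : GaussDominant r P a) (h0 : P.coeff a ≠ 0) :
    ∃ δ : ℝ, 0 ≤ δ ∧ δ < 1 ∧ ∀ i, i ≠ a → ‖P.coeff i‖ * r ^ i ≤ δ * (‖P.coeff a‖ * r ^ a) := by
  have hpos : 0 < ‖P.coeff a‖ * r ^ a := by positivity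
  have key : ∀ s : Finset ℕ, ∃ δ : ℝ, 0 ≤ δ ∧ δ < 1 ∧
      ∀ i ∈ s, i ≠ a → ‖P.coeff i‖ * r ^ i ≤ δ * (‖P.coeff a‖ * r ^ a) := by
    intro s
    induction s using Finset.induction_on with
    | empty => exact ⟨0, le_rfl, one_pos, by simp⟩
    | insert j s _ ih =>
      obtain ⟨δ, hδ0, h1, hδ⟩ := ih
      rcases eq_or_ne j a with rfl | hj
      · refine ⟨δ, hδ0, h1, fun i hi hij => ?_⟩
        exact hδ i ((Finset.mem_insert.1 hi).resolve_left hij) hij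
      · refine ⟨max δ (‖P.coeff j‖ * r ^ j / (‖P.coeff a‖ * r ^ a)), le_max_of_le_left hδ0,
          max_lt h1 ((div_lt_one hpos).2 (h j hj)), fun i hi hia => ?_⟩
        rcases Finset.mem_insert.1 hi with rfl | hi
        · rw [← div_le_iff₀ hpos]
          exact le_max_right _ _
        · exact (hδ i hi hia).trans (by gcongr; exact le_max_left _ _)
  obtain ⟨δ, hδ0, h1, hδ⟩ := key P.support
  refine ⟨δ, hδ0, h1, fun i hi => ?_⟩
  by_cases his : i ∈ P.support
  · exact hδ i his hi
  · rw [notMem_support_iff.1 his]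
    simp only [norm_zero, zero_mul]
    positivity

/-- On the closed disc the constant term strictly exceeds all other terms of the value, and an
ultrametric sum with a unique largest term cannot vanish. -/
theorem eval_ne_zero_of_le [IsUltrametricDist K] (hr : 0 < r) (h : GaussDominant r P 0)
    {z : K} (hz : ‖z‖ ≤ r) (h0 : P.coeff 0 ≠ 0) : P.eval z ≠ 0 := by
  intro hev
  obtain ⟨δ, hδ0, hδ1, hδ⟩ := h.exists_ratio hr h0
  simp only [pow_zero, mul_one] at hδ
  have hpos : 0 < ‖P.coeff 0‖ := norm_pos_iff.2 h0
  rw [← divX_mul_X_add P, eval_add, eval_C, eval_mul_X, add_eq_zero_iff_eq_neg'] at hev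
  have : ‖P.coeff 0‖ ≤ δ * ‖P.coeff 0‖ := by
    conv_lhs => rw [hev, norm_neg, eval_eq_sum_range, Finset.sum_mul]
    refine IsUltrametricDist.norm_sum_le_of_forall_le_of_nonneg (by positivity) fun i _ => ?_
    rw [mul_assoc, ← pow_succ, norm_mul, norm_pow, coeff_divX]
    exact le_trans (by gcongr) (hδ (i + 1) (by omega))
  nlinarith

theorem eval_ne_zero_of_ge [IsUltrametricDist K] (hr : 0 < r) (hP : P.Monic)
    (h : GaussDominant r P P.natDegree) {z : K} (hz : r ≤ ‖z‖) : P.eval z ≠ 0 := by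
  intro hev
  have h1 : P.coeff P.natDegree = 1 := hP
  obtain ⟨δ, hδ0, hδ1, hδ⟩ := h.exists_ratio hr (by rw [h1]; exact one_ne_zero)
  rw [h1, norm_one, one_mul] at hδ
  have hz0 : 0 < ‖z‖ := hr.trans_le hz
  have hpos : 0 < ‖z‖ ^ P.natDegree := by positivity
  rw [eval_eq_sum_range, Finset.sum_range_succ, h1, one_mul, add_eq_zero_iff_eq_neg'] at hev
  have : ‖z‖ ^ P.natDegree ≤ δ * ‖z‖ ^ P.natDegree := by
    conv_lhs => rw [← norm_pow, hev, norm_neg]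
    refine IsUltrametricDist.norm_sum_le_of_forall_le_of_nonneg (by positivity) fun i hi => ?_
    have hi := Finset.mem_range.1 hi
    -- Cancelling `r ^ i` leaves a bound by `δ * r ^ l`, and `r ≤ ‖z‖` turns it into `δ * ‖z‖ ^ l`.
    obtain ⟨l, hl⟩ := Nat.exists_eq_add_of_le hi.le
    have h2 := hδ i hi.ne
    rw [hl, pow_add, mul_left_comm, mul_comm] at h2
    have h3 := le_of_mul_le_mul_left h2 (by positivity)
    rw [norm_mul, norm_pow, hl, pow_add, mul_left_comm, mul_comm]
    gcongr
    exact h3.trans (by gcongr)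
  nlinarith

variable [IsUltrametricDist K]

/-- A product of polynomials with dominant terms, up to an error of smaller Gauss norm, has a
dominant term. -/
theorem mul_add (hr : 0 < r) (hP : GaussDominant r P a) (hQ : GaussDominant r Q b)
    (hP0 : P.coeff a ≠ 0) (hQ0 : Q.coeff b ≠ 0) {ε : ℝ} (hε1 : ε < 1)
    {E : K[X]} (hE : GaussBound r E (ε * (‖P.coeff a‖ * r ^ a) * (‖Q.coeff b‖ * r ^ b))) :
    GaussDominant r (P * Q + E) (a + b) ∧ (P * Q + E).coeff (a + b) ≠ 0 := by
  have hPa : 0 < ‖P.coeff a‖ * r ^ a := by positivity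
  have hQb : 0 < ‖Q.coeff b‖ * r ^ b := by positivity
  have hEi : ∀ i, ‖E.coeff i‖ * r ^ i < (‖P.coeff a‖ * r ^ a) * (‖Q.coeff b‖ * r ^ b) := by
    intro i
    refine (hE i).trans_lt ?_
    rw [mul_assoc]
    exact mul_lt_of_lt_one_left (by positivity) hε1
  have hterm : ∀ i j, (i, j) ≠ (a, b) → ‖P.coeff i * Q.coeff j‖ * r ^ (i + j) <
      (‖P.coeff a‖ * r ^ a) * (‖Q.coeff b‖ * r ^ b) := by
    intro i j hij
    rw [norm_mul, pow_add, mul_mul_mul_comm]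
    by_cases hi : i = a
    · subst hi
      exact mul_lt_mul_of_pos_left (hQ j fun h => hij (by rw [h])) hPa
    · exact (mul_le_mul_of_nonneg_left (hQ.gaussBound j) (by positivity)).trans_lt
        (mul_lt_mul_of_pos_right (hP i hi) hQb)
  -- The finite set is left free to serve twice: the antidiagonal of `a + b` without `(a, b)`, and
  -- the whole antidiagonal of any other index.
  have hsum : ∀ (n : ℕ) (s : Finset (ℕ × ℕ)), (∀ x ∈ s, x.1 + x.2 = n ∧ x ≠ (a, b)) →
      ‖∑ x ∈ s, P.coeff x.1 * Q.coeff x.2 + E.coeff n‖ * r ^ n <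
        (‖P.coeff a‖ * r ^ a) * (‖Q.coeff b‖ * r ^ b) := by
    intro n s hs
    rw [← lt_div_iff₀ (by positivity)]
    refine (IsUltrametricDist.norm_add_le_max _ _).trans_lt (max_lt ?_ ?_)
    · rcases s.eq_empty_or_nonempty with rfl | hne
      · rw [Finset.sum_empty, norm_zero]
        positivity
      obtain ⟨x, hx, hle⟩ := IsUltrametricDist.exists_norm_finsetSum_le_of_nonempty hne
        fun x : ℕ × ℕ => P.coeff x.1 * Q.coeff x.2
      refine hle.trans_lt ?_
      rw [lt_div_iff₀ (by positivity), ← (hs x hx).1]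
      exact hterm _ _ (hs x hx).2
    · rw [lt_div_iff₀ (by positivity)]
      exact hEi n
  have hmain : ‖(P * Q + E).coeff (a + b)‖ = ‖P.coeff a‖ * ‖Q.coeff b‖ := by
    rw [Polynomial.coeff_add, coeff_mul, ← Finset.add_sum_erase _ _
      (Finset.HasAntidiagonal.mem_antidiagonal.2 (rfl : (a, b).1 + (a, b).2 = a + b)), add_assoc]
    have h := hsum (a + b) ((Finset.HasAntidiagonal.antidiagonal (a + b)).erase (a, b)) fun x hx => by
      rw [Finset.mem_erase, Finset.HasAntidiagonal.mem_antidiagonal] at hx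
      exact ⟨hx.2, hx.1⟩
    rw [mul_mul_mul_comm, ← pow_add] at h
    have h := lt_of_mul_lt_mul_right h (by positivity)
    rw [← norm_mul] at h ⊢
    rw [IsUltrametricDist.norm_add_eq_max_of_norm_ne_norm h.ne', max_eq_left h.le]
  refine ⟨fun n hn => ?_, ?_⟩
  · rw [hmain, pow_add, mul_mul_mul_comm, coeff_add, coeff_mul]
    refine hsum n _ fun x hx => ?_
    rw [Finset.HasAntidiagonal.mem_antidiagonal] at hx
    refine ⟨hx, ?_⟩
    rintro rfl
    exact hn hx.symm
  · rw [← norm_ne_zero_iff, hmain]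
    positivity

end GaussDominant

end Bounds

/-! ### Hensel factorization for deformations of the product of polynomials -/

section Hensel

variable {K : Type*} [NormedField K] [IsUltrametricDist K]

/-- Euclidean division by a monic polynomial whose Gauss norm is that of its leading term does not
increase Gauss norms. -/
theorem exists_division_gaussBound {r : ℝ} (hr : 0 < r) {A : K[X]} {a : ℕ} (hA : A.Monic)
    (ha : A.natDegree = a) (hAr : GaussBound r A (r ^ a)) {C : ℝ} (n : ℕ) :
    ∀ F : K[X], F.degree < n → GaussBound r F (r ^ a * C) → ∃ V R : K[X], F = A * V + R ∧
      R.degree < a ∧ V.degree < (n - a : ℕ) ∧ GaussBound r V C ∧ GaussBound r R (r ^ a * C) := by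
  induction n with
  | zero =>
    intro F hF hFC
    have hC : 0 ≤ C := nonneg_of_mul_nonneg_right hFC.nonneg (by positivity)
    have hF0 : F = 0 := by
      simpa using hF
    refine ⟨0, 0, by simpa using hF0, ?_, ?_, .zero hC, .zero (by positivity)⟩ <;> simp
  | succ n ih =>
    intro F hF hFC
    have hC : 0 ≤ C := nonneg_of_mul_nonneg_right hFC.nonneg (by positivity)
    rcases lt_or_ge n a with hna | hna
    · refine ⟨0, F, by simp, hF.trans_le (by exact_mod_cast hna), by simp, .zero hC, hFC⟩
    obtain ⟨l, rfl⟩ := Nat.exists_eq_add_of_le hna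
    have hM : ‖F.coeff (a + l)‖ * r ^ l ≤ C := by
      have h := hFC (a + l)
      rw [pow_add, mul_left_comm] at h
      exact le_of_mul_le_mul_left h (by positivity)
    -- Removing the top term by a multiple of the monic `A` lowers the degree bound by one, and the
    -- Gauss bound survives by the ultrametric inequality.
    have hdeg : (F - A * monomial l (F.coeff (a + l))).degree < (a + l : ℕ) := by
      rw [degree_lt_iff_coeff_zero] at hF ⊢
      intro i hi
      obtain ⟨j, rfl⟩ := Nat.exists_eq_add_of_le hi
      rw [coeff_sub, add_right_comm, coeff_mul_monomial]
      rcases j with _ | j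
      · have : A.coeff a = 1 := ha ▸ hA
        simp [this]
      · rw [coeff_eq_zero_of_natDegree_lt (p := A) (by omega), hF _ (by omega)]
        simp
    obtain ⟨V, R, hF', hR, hV, hVC, hRC⟩ := ih _ hdeg
      (hFC.sub hr.le (hAr.mul hr.le (.monomial l hC hM)))
    refine ⟨monomial l (F.coeff (a + l)) + V, R, ?_, hR, ?_, (GaussBound.monomial l hC hM).add hr.le hVC,
      hRC⟩
    · rw [mul_add, add_assoc, ← hF']
      ring
    · rw [add_assoc, Nat.add_sub_cancel_left] at *
      refine (degree_add_le _ _).trans_lt (max_lt ?_ (hV.trans (by exact_mod_cast Nat.lt_succ_self l)))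
      exact (degree_monomial_le _ _).trans_lt (by exact_mod_cast Nat.lt_succ_self l)

/-- A sequence of polynomials of bounded degree that is Cauchy at a geometric rate converges. -/
theorem exists_gaussBound_limit [CompleteSpace K] {r : ℝ} (hr : 0 < r) {C η : ℝ} (hη : 0 ≤ η)
    (hη1 : η < 1) {N : ℕ} (F : ℕ → K[X]) (hN : ∀ n, (F n).natDegree ≤ N)
    (hF : ∀ n, GaussBound r (F (n + 1) - F n) (C * η ^ n)) :
    ∃ G : K[X], (∀ i, Filter.Tendsto (fun n => (F n).coeff i) Filter.atTop (nhds (G.coeff i))) ∧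
      ∀ n, GaussBound r (G - F n) (C * η ^ n) := by
  have hC : 0 ≤ C := by simpa using (hF 0).nonneg
  have hcauchy : ∀ i, CauchySeq fun n => (F n).coeff i := fun i => by
    refine cauchySeq_of_le_geometric η (C / r ^ i) hη1 fun n => ?_
    have h := hF n i
    rw [coeff_sub] at h
    rw [dist_comm, dist_eq_norm, div_mul_eq_mul_div, le_div_iff₀ (by positivity)]
    exact h
  choose g hg using fun i => cauchySeq_tendsto_of_complete (hcauchy i)
  have hg0 : ∀ i, N < i → g i = 0 := fun i hi => by
    refine tendsto_nhds_unique (hg i) ?_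
    simp only [fun n => coeff_eq_zero_of_natDegree_lt ((hN n).trans_lt hi)]
    exact tendsto_const_nhds
  have hG : ∀ i, (∑ j ∈ Finset.range (N + 1), monomial j (g j)).coeff i = g i := fun i => by
    simp only [finsetSum_coeff, coeff_monomial, Finset.sum_ite_eq', Finset.mem_range]
    split_ifs with h
    · rfl
    · exact (hg0 i (by omega)).symm
  -- Ultrametrically, all increments from `n` on are controlled by the first bound; no geometric
  -- series has to be summed.
  have hdiff : ∀ n l, GaussBound r (F (n + l) - F n) (C * η ^ n) := fun n l => by
    induction l with
    | zero => simpa using GaussBound.zero (by positivity)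
    | succ l ih =>
      have h := ((hF (n + l)).mono (mul_le_mul_of_nonneg_left
        (pow_le_pow_of_le_one hη hη1.le (Nat.le_add_right n l)) hC)).add hr.le ih
      rwa [sub_add_sub_cancel] at h
  refine ⟨_, fun i => (hG i).symm ▸ hg i, fun n i => ?_⟩
  rw [coeff_sub, hG]
  have ht := ((((hg i).comp (Filter.tendsto_add_atTop_nat n)).sub_const ((F n).coeff i)).norm).mul_const
    (r ^ i)
  refine le_of_tendsto' ht fun l => ?_
  have h := hdiff n l i
  rwa [coeff_sub, add_comm] at h

/-- A biadditive operation on polynomials that agrees with the product up to terms of smaller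
degree, and, for the Gauss norm of radius `r`, up to a factor `ε`. -/
structure IsProductDeformation (r ε : ℝ) (m : K[X] →+ K[X] →+ K[X]) : Prop where
  gaussBound : ∀ {A B : K[X]} {C D : ℝ}, GaussBound r A C → GaussBound r B D →
    GaussBound r (m A B - A * B) (ε * C * D)
  degree_lt : ∀ {A B : K[X]} {a b : ℕ}, A.natDegree ≤ a → B.natDegree ≤ b →
    (m A B - A * B).degree < (a + b : ℕ)

/-! ### Newton iteration for a deformed product -/

namespace IsProductDeformation

variable {r ε : ℝ} {m : K[X] →+ K[X] →+ K[X]}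

omit [IsUltrametricDist K] in
-- The opposite product satisfies the same bounds; this is what permits both orders of the factors
-- in the disc factorization.
theorem flip (h : IsProductDeformation r ε m) : IsProductDeformation r ε m.flip where
  gaussBound hA hB := by
    rw [AddMonoidHom.flip_apply, mul_comm, mul_right_comm]
    exact h.gaussBound hB hA
  degree_lt hA hB := by
    rw [AddMonoidHom.flip_apply, mul_comm, add_comm]
    exact h.degree_lt hB hA

theorem gaussBound_apply (h : IsProductDeformation r ε m) (hr : 0 ≤ r) (hε : ε ≤ 1) {A B : K[X]}
    {C D : ℝ} (hA : GaussBound r A C) (hB : GaussBound r B D) : GaussBound r (m A B) (C * D) := by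
  have h1 : GaussBound r (m A B - A * B) (C * D) := (h.gaussBound hA hB).mono <| by
    rw [mul_assoc]
    exact mul_le_of_le_one_left (mul_nonneg hA.nonneg hB.nonneg) hε
  simpa using h1.add hr (hA.mul hr hB)

omit [IsUltrametricDist K] in
theorem monic_apply (h : IsProductDeformation r ε m) {A B : K[X]} (hA : A.Monic) (hB : B.Monic) :
    (m A B).Monic ∧ (m A B).natDegree = A.natDegree + B.natDegree := by
  have hlt : (m A B - A * B).degree < (A * B).degree := by
    rw [degree_eq_natDegree (hA.mul hB).ne_zero, hA.natDegree_mul hB]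
    exact h.degree_lt le_rfl le_rfl
  have he : m A B = A * B + (m A B - A * B) := by ring
  rw [he]
  refine ⟨(hA.mul hB).add_of_left hlt, ?_⟩
  rw [natDegree_add_eq_left_of_degree_lt hlt, hA.natDegree_mul hB]

/-- The state after `n` steps of the iteration that factors `P` as `m A B`. -/
structure ApproxFactorization (r η : ℝ) (m : K[X] →+ K[X] →+ K[X]) (P : K[X]) (a b : ℕ) (β : K)
    (n : ℕ) (A B : K[X]) : Prop where
  monic_left : A.Monic
  natDegree_left : A.natDegree = a
  monic_right : B.Monic
  natDegree_right : B.natDegree = b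
  -- These two bounds do not improve with `n`: they keep the factors near `X ^ a` and `β` while the
  -- error `P - m A B` shrinks.
  bound_left : GaussBound r (A - X ^ a) (r ^ a * η)
  bound_right : GaussBound r (B - C β) (‖β‖ * η)
  bound : GaussBound r (P - m A B) (r ^ a * (‖β‖ * η ^ (n + 1)))

theorem ApproxFactorization.gaussBound_left {η : ℝ} {P : K[X]} {a b : ℕ} {β : K} {n : ℕ}
    {A B : K[X]} (h : ApproxFactorization r η m P a b β n A B) (hr : 0 ≤ r) (hη1 : η ≤ 1) :
    GaussBound r A (r ^ a) := by
  have hX : GaussBound r (X ^ a : K[X]) (r ^ a) := by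
    rw [← monomial_one_right_eq_X_pow]
    exact .monomial a (by positivity) (by simp)
  have := (h.bound_left.mono (mul_le_of_le_one_right (by positivity) hη1)).add hr hX
  simpa using this

theorem ApproxFactorization.gaussBound_right {η : ℝ} {P : K[X]} {a b : ℕ} {β : K} {n : ℕ}
    {A B : K[X]} (h : ApproxFactorization r η m P a b β n A B) (hr : 0 ≤ r) (hη1 : η ≤ 1) :
    GaussBound r B ‖β‖ := by
  have hX : GaussBound r (C β) ‖β‖ := by
    rw [← monomial_zero_left]
    exact .monomial 0 (by positivity) (by simp)
  have := (h.bound_right.mono (mul_le_of_le_one_right (by positivity) hη1)).add hr hX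
  simpa using this

/-- Newton step: divide the error by `A` as `A * V + R`, and use `V` to correct `B` and `R / β` to
correct `A`. The remaining error comes from the deformation (rate `ε`), from replacing `B` by `β`
(rate `η`), and from the quadratic term. -/
theorem ApproxFactorization.step (hm : IsProductDeformation r ε m) (hr : 0 < r) {η : ℝ}
    (hεη : ε ≤ η) (hη0 : 0 ≤ η) (hη1 : η ≤ 1) {P : K[X]} (hP : P.Monic) {a b : ℕ}
    (hab : P.natDegree = a + b) {β : K} (hβ : β ≠ 0) {n : ℕ} {A B : K[X]}
    (h : ApproxFactorization r η m P a b β n A B) :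
    ∃ A' B' : K[X], ApproxFactorization r η m P a b β (n + 1) A' B' ∧
      GaussBound r (A' - A) (r ^ a * η ^ (n + 1)) ∧ GaussBound r (B' - B) (‖β‖ * η ^ (n + 1)) := by
  have hβ0 : 0 < ‖β‖ := norm_pos_iff.2 hβ
  have hAr := h.gaussBound_left hr.le hη1
  have hBr := h.gaussBound_right hr.le hη1
  have hpow : η ^ (n + 1) ≤ η := pow_le_of_le_one hη0 hη1 n.succ_ne_zero
  obtain ⟨hmon, hmdeg⟩ := hm.monic_apply h.monic_left h.monic_right
  rw [h.natDegree_left, h.natDegree_right] at hmdeg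
  have hFdeg : (P - m A B).degree < (a + b : ℕ) := by
    have hd : P.degree = (a + b : ℕ) := by rw [degree_eq_natDegree hP.ne_zero, hab]
    have hd' : (m A B).degree = (a + b : ℕ) := by rw [degree_eq_natDegree hmon.ne_zero, hmdeg]
    rw [← hd]
    exact degree_sub_lt_left (hd.trans hd'.symm) hP.ne_zero (hP.leadingCoeff.trans hmon.leadingCoeff.symm)
  obtain ⟨V, R, hF, hRdeg, hVdeg, hV, hR⟩ := exists_division_gaussBound hr h.monic_left
    h.natDegree_left hAr (a + b) (P - m A B) hFdeg h.bound
  rw [Nat.add_sub_cancel_left] at hVdeg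
  -- Ideally `U * B = R`; since `B` equals `β` up to relative size `η`, dividing by the constant `β`
  -- suffices.
  set U : K[X] := C β⁻¹ * R with hU
  have hUR : C β * U = R := by
    rw [hU, ← mul_assoc, ← C_mul, mul_inv_cancel₀ hβ, C_1, one_mul]
  have hUdeg : U.degree < a := by
    rw [hU, degree_C_mul (inv_ne_zero hβ)]
    exact hRdeg
  have hUr : GaussBound r U (r ^ a * η ^ (n + 1)) := fun i => by
    rw [hU, coeff_C_mul, norm_mul, norm_inv, mul_assoc, inv_mul_le_iff₀ hβ0]
    exact (hR i).trans_eq (by ring)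
  have hAdeg : A.degree = a := by
    rw [degree_eq_natDegree h.monic_left.ne_zero, h.natDegree_left]
  have hBdeg : B.degree = b := by
    rw [degree_eq_natDegree h.monic_right.ne_zero, h.natDegree_right]
  refine ⟨A + U, B + V, ⟨h.monic_left.add_of_left (hUdeg.trans_eq hAdeg.symm), ?_,
    h.monic_right.add_of_left (hVdeg.trans_eq hBdeg.symm), ?_, ?_, ?_, ?_⟩, by simpa using hUr,
    by simpa using hV⟩
  · rw [natDegree_add_eq_left_of_degree_lt (hUdeg.trans_eq hAdeg.symm), h.natDegree_left]
  · rw [natDegree_add_eq_left_of_degree_lt (hVdeg.trans_eq hBdeg.symm), h.natDegree_right]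
  · rw [add_sub_right_comm]
    exact h.bound_left.add hr.le (hUr.mono (by gcongr))
  · rw [add_sub_right_comm]
    exact h.bound_right.add hr.le (hV.mono (by gcongr))
  · have hnew : P - m (A + U) (B + V) =
        -(m A V - A * V) - (m U B - U * B) - U * (B - C β) - m U V := by
      simp only [map_add, AddMonoidHom.add_apply]
      linear_combination hF - hUR
    rw [hnew]
    have hbd : ∀ {Q : K[X]} {D : ℝ}, GaussBound r Q D →
        D ≤ η * (r ^ a * ‖β‖ * η ^ (n + 1)) → GaussBound r Q (r ^ a * (‖β‖ * η ^ (n + 1 + 1))) :=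
      fun hQ hD => hQ.mono (hD.trans_eq (by ring))
    have hε' : ε * (r ^ a * ‖β‖ * η ^ (n + 1)) ≤ η * (r ^ a * ‖β‖ * η ^ (n + 1)) := by gcongr
    refine (((hbd (hm.gaussBound hAr hV).neg ?_).sub hr.le (hbd (hm.gaussBound hUr hBr) ?_)).sub
      hr.le (hbd (hUr.mul hr.le h.bound_right) ?_)).sub hr.le
      (hbd (hm.gaussBound_apply hr.le (hεη.trans hη1) hUr hV) ?_)
    · exact le_trans (by apply le_of_eq; ring) hε'
    · exact le_trans (by apply le_of_eq; ring) hε'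
    · exact le_of_eq (by ring)
    · calc r ^ a * η ^ (n + 1) * (‖β‖ * η ^ (n + 1))
          = η ^ (n + 1) * (r ^ a * ‖β‖ * η ^ (n + 1)) := by ring
        _ ≤ η * (r ^ a * ‖β‖ * η ^ (n + 1)) := by gcongr

/-- Hensel factorization: a monic polynomial whose Gauss norm is attained at a single term factors
with respect to a deformation of the product into a factor dominated by its leading term and a
factor dominated by its constant term. -/
theorem exists_factorization [CompleteSpace K] (hm : IsProductDeformation r ε m) (hr : 0 < r)
    (hε0 : 0 ≤ ε) (hε1 : ε < 1) {P : K[X]} (hP : P.Monic) {a : ℕ} (ha : P.coeff a ≠ 0)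
    (hdom : GaussDominant r P a) :
    ∃ A B : K[X], A.Monic ∧ B.Monic ∧ P = m A B ∧ GaussDominant r A A.natDegree ∧
      GaussDominant r B 0 := by
  obtain ⟨δ, hδ0, hδ1, hδ⟩ := hdom.exists_ratio hr ha
  obtain ⟨b, hab⟩ := Nat.exists_eq_add_of_le (le_natDegree_of_ne_zero ha)
  set β := P.coeff a with hβ
  have hβ0 : 0 < ‖β‖ := norm_pos_iff.2 ha
  -- The rate must absorb both the deformation and the non-dominant terms of `P`.
  set η := max ε δ with hη
  have hη0 : 0 ≤ η := le_max_of_le_left hε0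
  have hη1 : η < 1 := max_lt hε1 hδ1
  have hεη : ε ≤ η := le_max_left _ _
  have hPη : ∀ i, i ≠ a → ‖P.coeff i‖ * r ^ i ≤ r ^ a * (‖β‖ * η) := fun i hi =>
    (hδ i hi).trans (by
      rw [mul_comm ‖β‖, mul_left_comm, mul_comm δ]
      gcongr
      exact le_max_right _ _)
  have hXr : GaussBound r (X ^ a : K[X]) (r ^ a) := by
    rw [← monomial_one_right_eq_X_pow]
    exact .monomial a (by positivity) (by simp)
  have hstart : ∃ B : K[X], ApproxFactorization r η m P a b β 0 (X ^ a) B := by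
    -- `X ^ a * B` is the part of `P` of degree at least `a`; what it omits is small because the
    -- term of index `a` dominates.
    set B : K[X] := ∑ i ∈ Finset.range (b + 1), monomial i (P.coeff (a + i)) with hB
    have hBc : ∀ i, B.coeff i = P.coeff (a + i) := fun i => by
      simp only [hB, finsetSum_coeff, coeff_monomial, Finset.sum_ite_eq', Finset.mem_range]
      split_ifs with h
      · rfl
      · exact (coeff_eq_zero_of_natDegree_lt (by omega)).symm
    have hBle : B.natDegree ≤ b := natDegree_le_iff_coeff_eq_zero.2 fun i hi => by
      rw [hBc, coeff_eq_zero_of_natDegree_lt (by omega)]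
    have hB1 : B.coeff b = 1 := by
      rw [hBc, ← hab]
      exact hP
    have hBdeg : B.natDegree = b :=
      natDegree_eq_of_le_of_coeff_ne_zero hBle (by rw [hB1]; exact one_ne_zero)
    have hBmon : B.Monic := by
      rw [Monic, leadingCoeff, hBdeg, hB1]
    have hBη : GaussBound r (B - C β) (‖β‖ * η) := fun i => by
      rw [coeff_sub, hBc, coeff_C]
      split_ifs with hi
      · subst hi
        rw [add_zero, sub_self, norm_zero, zero_mul]
        positivity
      · have h := hPη (a + i) (by omega)
        rw [pow_add, mul_left_comm] at h
        rw [sub_zero]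
        exact le_of_mul_le_mul_left h (by positivity)
    have hBr : GaussBound r B ‖β‖ := by
      have h1 : GaussBound r (C β) ‖β‖ := by
        rw [← monomial_zero_left]
        exact .monomial 0 (by positivity) (by simp)
      have := (hBη.mono (mul_le_of_le_one_right (by positivity) hη1.le)).add hr.le h1
      simpa using this
    refine ⟨B, monic_X_pow a, natDegree_X_pow a, hBmon, hBdeg, ?_, hBη, ?_⟩
    · rw [sub_self]
      exact .zero (by positivity)
    · have h1 : GaussBound r (P - X ^ a * B) (r ^ a * (‖β‖ * η)) := fun i => by
        rw [coeff_sub, coeff_X_pow_mul']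
        split_ifs with hi
        · rw [hBc, Nat.add_sub_cancel' hi, sub_self, norm_zero, zero_mul]
          positivity
        · rw [sub_zero]
          exact hPη i (by omega)
      have h2 := (hm.gaussBound hXr hBr).mono
        (show ε * r ^ a * ‖β‖ ≤ r ^ a * (‖β‖ * η) by
          rw [mul_comm ε, mul_assoc, mul_comm ε]
          gcongr)
      have h3 := h1.sub hr.le h2
      rwa [sub_sub, add_sub_cancel, ← pow_one η] at h3
  obtain ⟨B₀, hB₀⟩ := hstart
  -- The invariant is placed inside the existential so that `choose` yields an unconditional step
  -- function; off the invariant the pair is left unchanged.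
  have hstep : ∀ (n : ℕ) (x : K[X] × K[X]), ∃ y : K[X] × K[X],
      ApproxFactorization r η m P a b β n x.1 x.2 →
        ApproxFactorization r η m P a b β (n + 1) y.1 y.2 ∧
          GaussBound r (y.1 - x.1) (r ^ a * η ^ (n + 1)) ∧
          GaussBound r (y.2 - x.2) (‖β‖ * η ^ (n + 1)) := fun n x => by
    by_cases hx : ApproxFactorization r η m P a b β n x.1 x.2
    · obtain ⟨A', B', h⟩ := hx.step hm hr hεη hη0 hη1.le hP hab ha
      exact ⟨(A', B'), fun _ => h⟩
    · exact ⟨x, fun h => absurd h hx⟩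
  choose f hf using hstep
  set s : ℕ → K[X] × K[X] := fun n => Nat.rec (X ^ a, B₀) f n with hs
  have hinv : ∀ n, ApproxFactorization r η m P a b β n (s n).1 (s n).2 := fun n => by
    induction n with
    | zero => exact hB₀
    | succ n ih => exact (hf n _ ih).1
  have hA : ∀ n, GaussBound r ((s (n + 1)).1 - (s n).1) (r ^ a * η * η ^ n) := fun n => by
    have h := (hf n _ (hinv n)).2.1
    rw [pow_succ'] at h
    rw [mul_assoc]
    exact h
  have hB : ∀ n, GaussBound r ((s (n + 1)).2 - (s n).2) (‖β‖ * η * η ^ n) := fun n => by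
    have h := (hf n _ (hinv n)).2.2
    rw [pow_succ'] at h
    rw [mul_assoc]
    exact h
  obtain ⟨A, hAlim, hAr⟩ := exists_gaussBound_limit hr hη0 hη1 (fun n => (s n).1)
    (fun n => (hinv n).natDegree_left.le) hA
  obtain ⟨B, hBlim, hBr⟩ := exists_gaussBound_limit hr hη0 hη1 (fun n => (s n).2)
    (fun n => (hinv n).natDegree_right.le) hB
  have hmonic : ∀ {F : ℕ → K[X]} {G : K[X]} {N : ℕ}, (∀ n, (F n).Monic) →
      (∀ n, (F n).natDegree = N) →
      (∀ i, Filter.Tendsto (fun n => (F n).coeff i) Filter.atTop (nhds (G.coeff i))) →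
      G.Monic ∧ G.natDegree = N := by
    intro F G N hF hN hlim
    have h1 : G.coeff N = 1 := by
      refine tendsto_nhds_unique (hlim N) ?_
      have : ∀ n, (F n).coeff N = 1 := fun n => hN n ▸ hF n
      simp only [this]
      exact tendsto_const_nhds
    have hle : G.natDegree ≤ N := natDegree_le_iff_coeff_eq_zero.2 fun i hi => by
      refine tendsto_nhds_unique (hlim i) ?_
      simp only [fun n => coeff_eq_zero_of_natDegree_lt ((hN n).trans_lt hi)]
      exact tendsto_const_nhds
    have hdeg := natDegree_eq_of_le_of_coeff_ne_zero hle (by rw [h1]; exact one_ne_zero)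
    exact ⟨by rw [Monic, leadingCoeff, hdeg, h1], hdeg⟩
  obtain ⟨hAm, hAd⟩ := hmonic (fun n => (hinv n).monic_left) (fun n => (hinv n).natDegree_left) hAlim
  obtain ⟨hBm, hBd⟩ := hmonic (fun n => (hinv n).monic_right) (fun n => (hinv n).natDegree_right)
    hBlim
  have hAX : GaussBound r (A - X ^ a) (r ^ a * η) := by
    have h := (hAr 0).add hr.le ((hinv 0).bound_left.mono (by rw [pow_zero, mul_one]))
    rwa [sub_add_sub_cancel, pow_zero, mul_one] at h
  have hBβ : GaussBound r (B - C β) (‖β‖ * η) := by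
    have h := (hBr 0).add hr.le ((hinv 0).bound_right.mono (by rw [pow_zero, mul_one]))
    rwa [sub_add_sub_cancel, pow_zero, mul_one] at h
  have hAr' : GaussBound r A (r ^ a) := by
    simpa using (hAX.mono (mul_le_of_le_one_right (by positivity) hη1.le)).add hr.le hXr
  refine ⟨A, B, hAm, hBm, ?_, fun i hi => ?_, fun i hi => ?_⟩
  · rw [← sub_eq_zero]
    refine eq_zero_of_forall_gaussBound (C := r ^ a * ‖β‖ * η) hr hη0 hη1 fun n => ?_
    -- Each of the three pieces is of order `η ^ (n + 1)`, for every `n`, so the limit factorization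
    -- is exact.
    have he : P - m A B = (P - m (s n).1 (s n).2) - m (A - (s n).1) (s n).2 -
        m A (B - (s n).2) := by
      simp only [map_sub, AddMonoidHom.sub_apply]
      abel
    rw [he]
    have h1 := (hinv n).bound
    have h2 := hm.gaussBound_apply hr.le hε1.le (hAr n) ((hinv n).gaussBound_right hr.le hη1.le)
    have h3 := hm.gaussBound_apply hr.le hε1.le hAr' (hBr n)
    refine ((h1.mono ?_).sub hr.le (h2.mono ?_)).sub hr.le (h3.mono ?_) <;>
      exact le_of_eq (by ring)
  · rw [hAd] at hi ⊢
    have h1 : A.coeff a = 1 := hAd ▸ hAm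
    have h := hAX i
    rw [coeff_sub, coeff_X_pow, if_neg hi, sub_zero] at h
    rw [h1, norm_one, one_mul]
    exact h.trans_lt (mul_lt_of_lt_one_right (by positivity) hη1)
  · have h := hBβ i
    rw [coeff_sub, coeff_C, if_neg hi, sub_zero] at h
    have h0 := hBβ 0
    rw [coeff_sub, coeff_C_zero, pow_zero, mul_one] at h0
    have hlt : ‖β‖ * η < ‖β‖ := mul_lt_of_lt_one_right hβ0 hη1
    have hB0 : ‖B.coeff 0‖ = ‖β‖ := by
      have hlt' : ‖B.coeff 0 + -β‖ < max ‖B.coeff 0‖ ‖-β‖ := by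
        rw [← sub_eq_add_neg, norm_neg]
        exact (h0.trans_lt hlt).trans_le (le_max_right _ _)
      simpa using IsUltrametricDist.norm_eq_of_add_norm_lt_max hlt'
    rw [hB0, pow_zero, mul_one]
    exact h.trans_lt hlt

end IsProductDeformation

end Hensel

/-! ### The product of differential polynomials as a deformation of the commutative product -/

namespace DiffPoly

section Algebraic

variable {k K : Type*} [Field k] [Field K] [Algebra k K] (d : Derivation k K K)

/-- The product of differential polynomials as a biadditive map on coefficient sequences. -/
def mulHom : K[X] →+ K[X] →+ K[X] :=
  AddMonoidHom.mk' (fun P => AddMonoidHom.mk' (mulAux d P) (mulAux_add_right P))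
    fun P P' => AddMonoidHom.ext fun Q => mulAux_add_left P P' Q

variable {d}

theorem mulHom_apply (P Q : K[X]) : mulHom d P Q = mulAux d P Q := rfl

theorem ofPoly_mulHom (P Q : K[X]) : ofPoly d (mulHom d P Q) = ofPoly d P * ofPoly d Q := rfl

theorem mulHom_one (P : K[X]) : mulHom d P 1 = P := mulAux_one P

theorem mulHom_assoc (P Q R : K[X]) :
    mulHom d (mulHom d P Q) R = mulHom d P (mulHom d Q R) := mulAux_assoc P Q R

theorem coeff_dMul (Q : K[X]) (i : ℕ) : (dMul d Q).coeff i = (X * Q).coeff i + d (Q.coeff i) := by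
  induction Q using Polynomial.induction_on' with
  | add p q hp hq => simp only [map_add, coeff_add, mul_add, hp, hq]; ring
  | monomial n b =>
    rw [dMul_monomial, coeff_add, X_mul_monomial]
    simp only [coeff_monomial]
    split_ifs <;> simp

theorem dMul_map (q : k[X]) : dMul d (q.map (algebraMap k K)) = X * q.map (algebraMap k K) := by
  ext i
  rw [coeff_dMul, coeff_map, d.map_algebraMap, add_zero]

theorem taylor_dMul (c : k) (Q : K[X]) : taylor (algebraMap k K c) (dMul d Q) =
    dMul d (taylor (algebraMap k K c) Q) +
      C (algebraMap k K c) * taylor (algebraMap k K c) Q := by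
  induction Q using Polynomial.induction_on' with
  | add p q hp hq => simp only [map_add, mul_add, hp, hq]; ring
  | monomial n b =>
    -- The power has coefficients in `k`, where `d` vanishes, so left multiplication by `d` acts on
    -- it as multiplication by `X`.
    have h : (X + C (algebraMap k K c)) ^ n = ((X + C c) ^ n).map (algebraMap k K) := by simp
    have h' : dMul d ((X + C (algebraMap k K c)) ^ n) = X * (X + C (algebraMap k K c)) ^ n := by
      rw [h, dMul_map]
    rw [dMul_monomial, map_add, taylor_monomial, taylor_monomial, taylor_monomial, dMul_C_mul, h']
    ring

theorem taylor_dMul_pow (c : k) (i : ℕ) (Q : K[X]) :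
    taylor (algebraMap k K c) ((dMul d ^ i) Q) =
      mulAux d ((X + C (algebraMap k K c)) ^ i) (taylor (algebraMap k K c) Q) := by
  induction i with
  | zero => simp [one_mulAux]
  | succ i ih =>
    have h : (X + C (algebraMap k K c)) ^ i = ((X + C c) ^ i).map (algebraMap k K) := by simp
    have h' : dMul d ((X + C (algebraMap k K c)) ^ i) = X * (X + C (algebraMap k K c)) ^ i := by
      rw [h, dMul_map]
    rw [pow_succ', Module.End.mul_apply, taylor_dMul, ih, pow_succ', add_mul, mulAux_add_left, ← h',
      mulAux_dMul, mulAux_C_mul]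

/-- Translations by constants are ring automorphisms for the product of differential
polynomials. -/
theorem taylor_mulHom (c : k) (P Q : K[X]) : taylor (algebraMap k K c) (mulHom d P Q) =
    mulHom d (taylor (algebraMap k K c) P) (taylor (algebraMap k K c) Q) := by
  simp only [mulHom_apply]
  induction P using Polynomial.induction_on' with
  | add p q hp hq => simp only [mulAux_add_left, map_add, hp, hq]
  | monomial n b =>
    rw [mulAux_monomial, taylor_mul, taylor_C, taylor_dMul_pow, taylor_monomial, mulAux_C_mul]

/-- Left multiplication by `d` differs from multiplication by `X` by `d` on coefficients, which does
not raise the degree. -/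
theorem degree_dMul_pow_sub_lt (i : ℕ) {Q : K[X]} {b : ℕ} (hQ : Q.natDegree ≤ b) :
    ((dMul d ^ i) Q - X ^ i * Q).degree < ((i + b : ℕ) : WithBot ℕ) := by
  induction i with
  | zero => simp
  | succ i ih =>
    rw [pow_succ', Module.End.mul_apply]
    rw [degree_lt_iff_coeff_zero] at ih ⊢
    intro n hn
    have hsplit : dMul d ((dMul d ^ i) Q) = dMul d ((dMul d ^ i) Q - X ^ i * Q) +
        dMul d (X ^ i * Q) := by rw [← map_add, sub_add_cancel]
    obtain ⟨n, rfl⟩ : ∃ l, n = l + 1 := ⟨n - 1, by omega⟩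
    have hX : (X ^ i * Q).coeff (n + 1) = 0 := by
      rw [coeff_X_pow_mul', if_pos (by omega), coeff_eq_zero_of_natDegree_lt (by omega)]
    rw [hsplit, coeff_sub, coeff_add, coeff_dMul, coeff_dMul, coeff_X_mul, ih n (by omega),
      ih (n + 1) (by omega), hX, map_zero, pow_succ', mul_assoc]
    ring

theorem degree_mulHom_sub_lt {A B : K[X]} {a b : ℕ} (hA : A.natDegree ≤ a)
    (hB : B.natDegree ≤ b) : (mulHom d A B - A * B).degree < (a + b : ℕ) := by
  have h : mulHom d A B - A * B =
      ∑ i ∈ Finset.range (a + 1), C (A.coeff i) * ((dMul d ^ i) B - X ^ i * B) := by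
    conv_lhs => rw [A.as_sum_range' (a + 1) (by omega)]
    simp only [map_sum, AddMonoidHom.finsetSum_apply, Finset.sum_mul, ← Finset.sum_sub_distrib]
    refine Finset.sum_congr rfl fun i _ => ?_
    rw [mulHom_apply, mulAux_monomial, ← C_mul_X_pow_eq_monomial]
    ring
  rw [h, ← mem_degreeLT]
  refine Submodule.sum_mem _ fun i hi => ?_
  rw [← smul_eq_C_mul]
  refine Submodule.smul_mem _ _ (mem_degreeLT.2 ?_)
  refine (degree_dMul_pow_sub_lt i hB).trans_le ?_
  have := Finset.mem_range.1 hi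
  exact_mod_cast (by omega : i + b ≤ a + b)

end Algebraic

section Normed

variable {k K : Type*} [NormedField k] [NormedField K] [IsUltrametricDist K] [NormedAlgebra k K]
  {d : Derivation k K K}

omit [IsUltrametricDist K] in
theorem gaussBound_dMul_sub {r ρ : ℝ} (hr : 0 < r) (hd : ∀ f, ‖d f‖ ≤ ρ * ‖f‖) (hρ : 0 ≤ ρ)
    {Q : K[X]} {D : ℝ} (hQ : GaussBound r Q D) : GaussBound r (dMul d Q - X * Q) (ρ * D) :=
  fun i => by
    rw [coeff_sub, coeff_dMul, add_sub_cancel_left]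
    calc ‖d (Q.coeff i)‖ * r ^ i ≤ ρ * ‖Q.coeff i‖ * r ^ i := by gcongr; exact hd _
      _ = ρ * (‖Q.coeff i‖ * r ^ i) := by ring
      _ ≤ ρ * D := by gcongr; exact hQ i

omit [IsUltrametricDist K] in
theorem gaussBound_X_pow_mul {r : ℝ} (hr : 0 ≤ r) (i : ℕ) {Q : K[X]} {D : ℝ}
    (hQ : GaussBound r Q D) : GaussBound r (X ^ i * Q) (r ^ i * D) := by
  rw [← monomial_one_right_eq_X_pow]
  exact .monomial_mul hr i (by simp) hQ

/-- The ultrametric inequality takes the maximum of the errors made at each application of `d`, so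
the relative error stays `ρ / r` for every power. -/
theorem gaussBound_dMul_pow_sub {r ρ : ℝ} (hr : 0 < r) (hd : ∀ f, ‖d f‖ ≤ ρ * ‖f‖) (hρ : 0 ≤ ρ)
    (hρr : ρ ≤ r) {Q : K[X]} {D : ℝ} (hQ : GaussBound r Q D) (i : ℕ) :
    GaussBound r ((dMul d ^ i) Q - X ^ i * Q) (ρ / r * r ^ i * D) := by
  have hD := hQ.nonneg
  induction i with
  | zero =>
    rw [pow_zero, pow_zero, Module.End.one_apply, one_mul, sub_self]
    exact .zero (by positivity)
  | succ i ih =>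
    have hsplit : (dMul d ^ (i + 1)) Q - X ^ (i + 1) * Q =
        (dMul d ((dMul d ^ i) Q - X ^ i * Q) - X * ((dMul d ^ i) Q - X ^ i * Q)) +
        X ^ 1 * ((dMul d ^ i) Q - X ^ i * Q) +
        (dMul d (X ^ i * Q) - X * (X ^ i * Q)) := by
      rw [pow_succ', Module.End.mul_apply, map_sub]
      ring
    rw [hsplit]
    refine (((gaussBound_dMul_sub hr hd hρ ih).mono ?_).add hr.le
      ((gaussBound_X_pow_mul hr.le 1 ih).mono ?_)).add hr.le
      ((gaussBound_dMul_sub hr hd hρ (gaussBound_X_pow_mul hr.le i hQ)).mono ?_)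
    · calc ρ * (ρ / r * r ^ i * D) ≤ r * (ρ / r * r ^ i * D) := by gcongr
        _ = _ := by ring
    · exact le_of_eq (by ring)
    · exact le_of_eq (by rw [pow_succ]; field_simp)

theorem isProductDeformation {r ρ : ℝ} (hr : 0 < r) (hd : ∀ f, ‖d f‖ ≤ ρ * ‖f‖) (hρ : 0 ≤ ρ)
    (hρr : ρ ≤ r) : IsProductDeformation r (ρ / r) (mulHom d) where
  gaussBound {A B C' D} hA hB := by
    have h : mulHom d A B - A * B =
        ∑ i ∈ A.support, monomial 0 (A.coeff i) * ((dMul d ^ i) B - X ^ i * B) := by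
      conv_lhs => rw [A.as_sum_support]
      simp only [map_sum, AddMonoidHom.finsetSum_apply, Finset.sum_mul, ← Finset.sum_sub_distrib]
      refine Finset.sum_congr rfl fun i _ => ?_
      rw [mulHom_apply, mulAux_monomial, ← C_mul_X_pow_eq_monomial, monomial_zero_left]
      ring
    rw [h]
    have hC := hA.nonneg
    have hD := hB.nonneg
    refine GaussBound.sum hr.le (by positivity) _ _ fun i _ => ?_
    refine (GaussBound.monomial_mul (C := ‖A.coeff i‖) hr.le 0 (by simp)
      (gaussBound_dMul_pow_sub hr hd hρ hρr hB i)).mono ?_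
    calc ‖A.coeff i‖ * (ρ / r * r ^ i * D) = ρ / r * (‖A.coeff i‖ * r ^ i) * D := by ring
      _ ≤ ρ / r * C' * D := by gcongr; exact hA i
  degree_lt := degree_mulHom_sub_lt

end Normed

end DiffPoly

/-! ### The infimum defining the operator norm is itself a bound -/

section OperatorNorm

variable {k Ω : Type*} [NormedField k] [NormedField Ω] [NormedAlgebra k Ω]

theorem Derivation.operatorNorm_nonneg (d : Derivation k Ω Ω) : 0 ≤ d.operatorNorm :=
  Real.sInf_nonneg fun _ h => h.1

theorem Derivation.IsBounded.norm_apply_le {d : Derivation k Ω Ω} (hd : d.IsBounded) (f : Ω) :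
    ‖d f‖ ≤ d.operatorNorm * ‖f‖ := by
  rcases eq_or_ne f 0 with rfl | hf
  · simp
  obtain ⟨B, hB⟩ := hd
  rw [← div_le_iff₀ (norm_pos_iff.2 hf)]
  -- `B` may be negative, while the set defining the norm requires nonnegative constants; `max B 0`
  -- shows that it is nonempty.
  refine le_csInf ⟨max B 0, le_max_right _ _, fun g => (hB g).trans ?_⟩ fun C hC => ?_
  · gcongr
    exact le_max_left _ _
  · exact (div_le_iff₀ (norm_pos_iff.2 hf)).2 (hC.2 f)

end OperatorNorm

/-! ### Roots and dominant terms -/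

section Roots

variable {K : Type*} [NormedField K] [IsUltrametricDist K]

open Classical in
-- A factor `X - z` is dominated by `X` when `‖z‖ < r` and by its constant term when `‖z‖ > r`;
-- dominant indices add in products.
theorem gaussDominant_prod_X_sub_C {r : ℝ} (hr : 0 < r) (s : Multiset K) (hs : ∀ z ∈ s, ‖z‖ ≠ r) :
    GaussDominant r (s.map fun z => X - C z).prod (s.countP fun z => ‖z‖ ≤ r) ∧
      (s.map fun z => X - C z).prod.coeff (s.countP fun z => ‖z‖ ≤ r) ≠ 0 := by
  induction s using Multiset.induction_on with
  | empty =>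
    refine ⟨fun i hi => ?_, by simp⟩
    simp only [Multiset.countP_zero] at hi
    simp [coeff_one, hi]
  | cons z s ih =>
    obtain ⟨ih1, ih2⟩ := ih fun w hw => hs w (Multiset.mem_cons_of_mem hw)
    rw [Multiset.map_cons, Multiset.prod_cons, Multiset.countP_cons, add_comm]
    have hfactor : GaussDominant r (X - C z) (if ‖z‖ ≤ r then 1 else 0) ∧
        (X - C z).coeff (if ‖z‖ ≤ r then 1 else 0) ≠ 0 := by
      have hz := hs z (Multiset.mem_cons_self z s)
      have hc : ∀ i, (X - C z).coeff i = if i = 0 then -z else if i = 1 then 1 else 0 := by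
        intro i
        rw [coeff_sub, coeff_X, coeff_C]
        rcases i with _ | _ | i <;> simp
      split_ifs with h
      · refine ⟨fun i hi => ?_, by simp [hc]⟩
        rcases i with _ | _ | i
        · simpa [hc] using lt_of_le_of_ne h hz
        · exact absurd rfl hi
        · simpa [hc] using hr
      · have h := not_le.1 h
        refine ⟨fun i hi => ?_, by simpa [hc] using norm_pos_iff.1 (hr.trans h)⟩
        rcases i with _ | _ | i
        · exact absurd rfl hi
        · simpa [hc] using h
        · simpa [hc] using norm_pos_iff.1 (hr.trans h)
    have h := hfactor.1.mul_add hr ih1 hfactor.2 ih2 (E := 0) (ε := 0) one_pos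
      (.zero (by simp))
    rwa [add_zero] at h

variable {L : Type*} [NormedField L] [NormedAlgebra K L]

omit [IsUltrametricDist K] in
theorem gaussDominant_map {r : ℝ} {P : K[X]} {a : ℕ} :
    GaussDominant r (P.map (algebraMap K L)) a ↔ GaussDominant r P a := by
  simp only [GaussDominant, coeff_map, norm_algebraMap']

variable [IsAlgClosed L]

omit [IsUltrametricDist K] in
theorem map_taylor_eq_prod {P : K[X]} (hP : P.Monic) (c : K) :
    (taylor c P).map (algebraMap K L) =
      (((P.aroots L).map fun z => z - algebraMap K L c).map fun z => X - C z).prod := by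
  have h1 : P.map (algebraMap K L) = ((P.aroots L).map fun z => X - C z).prod :=
    (IsAlgClosed.splits _).eq_prod_roots_of_monic (hP.map _)
  have h2 : (taylor c P).map (algebraMap K L) = (P.map (algebraMap K L)).comp
      (X + C (algebraMap K L c)) := by
    rw [taylor_apply, Polynomial.map_comp]
    simp
  rw [h2, h1, Polynomial.multiset_prod_comp, Multiset.map_map, Multiset.map_map]
  refine congrArg _ (Multiset.map_congr rfl fun z _ => ?_)
  simp only [Function.comp_apply, sub_comp, X_comp, C_comp, map_sub]
  ring

variable (L) in
open Classical in
/-- The number of roots of `P` in `L`, with multiplicity, in the closed disc of radius `r` around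
`c`. -/
def rootCount (P : K[X]) (c : K) (r : ℝ) : ℕ :=
  (P.aroots L).countP fun z => ‖z - algebraMap K L c‖ ≤ r

/-- The product formula over `L` gives dominance there, and it descends to `K` because the extension
preserves norms. -/
theorem gaussDominant_taylor {r : ℝ} (hr : 0 < r) {P : K[X]} (hP : P.Monic) (c : K)
    (hs : ∀ z ∈ P.aroots L, ‖z - algebraMap K L c‖ ≠ r) :
    GaussDominant r (taylor c P) (rootCount L P c r) ∧ (taylor c P).coeff (rootCount L P c r) ≠ 0 := by
  classical
  have : IsUltrametricDist L := .of_normedAlgebra K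
  have h := gaussDominant_prod_X_sub_C hr ((P.aroots L).map fun z => z - algebraMap K L c) fun z hz => by
    obtain ⟨w, hw, rfl⟩ := Multiset.mem_map.1 hz
    exact hs w hw
  rw [← map_taylor_eq_prod hP, gaussDominant_map, coeff_map, Multiset.countP_map,
    ← Multiset.countP_eq_card_filter] at h
  refine ⟨h.1, fun h0 => h.2 ?_⟩
  change algebraMap K L ((taylor c P).coeff (rootCount L P c r)) = 0
  rw [h0, map_zero]

end Roots

/-! ### Root counts and factorizations relative to a disc -/

namespace DiffPoly

section Split

variable {k : Type*} [NormedField k]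
  {K : Type*} [NormedField K] [IsUltrametricDist K] [NormedAlgebra k K]
  {L : Type*} [NormedField L] [NormedAlgebra K L] [IsAlgClosed L]
  {d : Derivation k K K}

omit [IsUltrametricDist K] in
theorem monic_taylor {P : K[X]} (hP : P.Monic) (c : K) : (taylor c P).Monic := by
  rw [Monic, leadingCoeff_taylor, hP.leadingCoeff]

/-- The number of roots in a disc of radius greater than `‖d‖` is additive for the product of
differential polynomials. -/
theorem rootCount_mulHom {ρ r : ℝ} (hd : ∀ f, ‖d f‖ ≤ ρ * ‖f‖) (hρ : 0 ≤ ρ) (hρr : ρ < r)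
    {A B : K[X]} (hA : A.Monic) (hB : B.Monic) (hAB : (mulHom d A B).Monic) (c : k)
    (hs : ∀ z : L, z ∈ (mulHom d A B).aroots L ∨ z ∈ A.aroots L ∨ z ∈ B.aroots L →
      ‖z - algebraMap K L (algebraMap k K c)‖ ≠ r) :
    rootCount L (mulHom d A B) (algebraMap k K c) r =
      rootCount L A (algebraMap k K c) r + rootCount L B (algebraMap k K c) r := by
  have hr : 0 < r := hρ.trans_lt hρr
  obtain ⟨h1, -⟩ := gaussDominant_taylor hr hAB (algebraMap k K c) fun z hz => hs z (.inl hz)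
  obtain ⟨h2, h2'⟩ := gaussDominant_taylor hr hA (algebraMap k K c)
    fun z hz => hs z (.inr (.inl hz))
  obtain ⟨h3, h3'⟩ := gaussDominant_taylor hr hB (algebraMap k K c)
    fun z hz => hs z (.inr (.inr hz))
  have hm := isProductDeformation hr hd hρ hρr.le
  -- The dominant index of the deformed product is the sum of those of the factors, the deformation
  -- being an error of ratio `ρ / r < 1`.
  have h := (h2.mul_add hr h3 h2' h3' ((div_lt_one hr).2 hρr)
    (hm.gaussBound h2.gaussBound h3.gaussBound)).1
  rw [add_sub_cancel, ← taylor_mulHom] at h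
  exact h1.index_unique h

/-- Factorization of a differential polynomial according to the distance of its roots to a
constant. -/
theorem exists_factorization_disc [CompleteSpace K] {ρ r : ℝ} (hd : ∀ f, ‖d f‖ ≤ ρ * ‖f‖) (hρ : 0 ≤ ρ)
    (hρr : ρ < r) {m : K[X] →+ K[X] →+ K[X]} (hm : m = mulHom d ∨ m = (mulHom d).flip)
    {P : K[X]} (hP : P.Monic) (c : k)
    (hs : ∀ z ∈ P.aroots L, ‖z - algebraMap K L (algebraMap k K c)‖ ≠ r) :
    ∃ A B : K[X], A.Monic ∧ B.Monic ∧ P = m A B ∧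
      (∀ z ∈ A.aroots L, ‖z - algebraMap K L (algebraMap k K c)‖ < r) ∧
      ∀ z ∈ B.aroots L, r < ‖z - algebraMap K L (algebraMap k K c)‖ := by
  have hr : 0 < r := hρ.trans_lt hρr
  have : IsUltrametricDist L := .of_normedAlgebra K
  have hdef : IsProductDeformation r (ρ / r) m := by
    rcases hm with rfl | rfl
    · exact isProductDeformation hr hd hρ hρr.le
    · exact (isProductDeformation hr hd hρ hρr.le).flip
  have hτ : ∀ (c : k) (P Q : K[X]), taylor (algebraMap k K c) (m P Q) =
      m (taylor (algebraMap k K c) P) (taylor (algebraMap k K c) Q) := fun c P Q => by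
    rcases hm with rfl | rfl
    · exact taylor_mulHom c P Q
    · rw [AddMonoidHom.flip_apply, AddMonoidHom.flip_apply]
      exact taylor_mulHom c Q P
  obtain ⟨h1, h2⟩ := gaussDominant_taylor hr hP (algebraMap k K c) hs
  obtain ⟨A, B, hA, hB, hAB, hAr, hBr⟩ := hdef.exists_factorization hr (by positivity)
    ((div_lt_one hr).2 hρr) (monic_taylor hP _) h2 h1
  have heval : ∀ (Q : K[X]) (z : L), aeval z (taylor (algebraMap k K (-c)) Q) =
      (Q.map (algebraMap K L)).eval (z - algebraMap K L (algebraMap k K c)) := fun Q z => by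
    rw [taylor_apply, aeval_comp, eval_map_algebraMap]
    simp [sub_eq_add_neg]
  refine ⟨taylor (algebraMap k K (-c)) A, taylor (algebraMap k K (-c)) B, monic_taylor hA _,
    monic_taylor hB _, ?_, fun z hz => ?_, fun z hz => ?_⟩
  · rw [← hτ, ← hAB, taylor_taylor, map_neg, neg_add_cancel, taylor_zero]
  · by_contra hle
    refine GaussDominant.eval_ne_zero_of_ge hr (hA.map (algebraMap K L)) ?_ (not_lt.1 hle) ?_
    · rw [natDegree_map, gaussDominant_map]
      exact hAr
    · rw [← heval, (mem_aroots.1 hz).2]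
  · by_contra hle
    refine GaussDominant.eval_ne_zero_of_le hr (gaussDominant_map.2 hBr) (not_lt.1 hle) ?_ ?_
    · rw [coeff_map, Ne, map_eq_zero]
      intro h0
      -- If the constant term vanished, dominance would make the leading term, of norm `r ^
      -- B.natDegree`, negative.
      have h := hBr (B.natDegree) (fun hn => by
        have := hB.coeff_natDegree
        rw [hn, h0] at this
        exact zero_ne_one this)
      rw [h0, hB.coeff_natDegree] at h
      simp only [norm_one, one_mul, norm_zero, zero_mul] at h
      exact absurd h (not_lt.2 (by positivity))
    · rw [← heval, (mem_aroots.1 hz).2]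

end Split

end DiffPoly

/-! ### Separating points of the affine line by discs -/

section Separation

variable {k : Type*} [NormedField k] {L : Type*} [NormedField L] [NormedAlgebra k L]

/-- Polynomials over `k` split, so a multiplicative seminorm is determined by its values on the `X -
c`. -/
theorem BerkovichLine.ofElement_eq_iff [IsAlgClosed k] {z w : L} :
    ofElement k z = ofElement k w ↔
      ∀ c : k, ‖z - algebraMap k L c‖ = ‖w - algebraMap k L c‖ := by
  have hlin : ∀ (z : L) (c : k), ‖aeval z (X - C c)‖ = ‖z - algebraMap k L c‖ := fun z c => by simp
  constructor
  · intro h c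
    rw [← hlin, ← hlin, ← ofElement_apply, ← ofElement_apply, h]
  · intro h
    have key : (ofElement k z).seminorm = (ofElement k w).seminorm := by
      refine DFunLike.ext _ _ fun Q => ?_
      rw [ofElement_apply, ofElement_apply, (IsAlgClosed.splits Q).eq_prod_roots]
      simp only [map_mul, aeval_C, norm_mul]
      congr 1
      induction Q.roots using Multiset.induction_on with
      | empty => simp
      | cons c s ih => simp only [Multiset.map_cons, Multiset.prod_cons, map_mul, norm_mul, ih, hlin, h c]
    cases hz : ofElement k z
    cases hw : ofElement k w
    rw [hz, hw] at key
    simpa using key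

variable [IsUltrametricDist L]

variable (k) in
/-- The indicator functions of the discs of radius greater than `ρ` with center in `k` whose
boundary does not meet `E`, together with `0` and `1`. -/
def discSubmonoid (ρ : ℝ) (E : Set L) : Submonoid (L → ℤ) where
  carrier := {f | f = 0 ∨ f = 1 ∨ ∃ (c : k) (r : ℝ), ρ < r ∧
    (∀ z ∈ E, ‖z - algebraMap k L c‖ ≠ r) ∧
      f = (Metric.closedBall (algebraMap k L c) r).indicator 1}
  one_mem' := .inr (.inl rfl)
  mul_mem' := by
    rintro f g (rfl | rfl | ⟨c, r, hr, hE, rfl⟩) hg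
    · exact .inl (zero_mul g)
    · rwa [one_mul]
    rcases hg with rfl | rfl | ⟨c', r', hr', hE', rfl⟩
    · exact .inl (mul_zero _)
    · rw [mul_one]
      exact .inr (.inr ⟨c, r, hr, hE, rfl⟩)
    · rw [← Set.inter_indicator_one]
      -- Ultrametric discs are nested or disjoint, so products of indicators stay in the family.
      rcases IsUltrametricDist.closedBall_subset_trichotomy (x := algebraMap k L c) (r := r)
        (y := algebraMap k L c') (s := r') with h | h | h
      · rw [Set.inter_eq_left.2 h]
        exact .inr (.inr ⟨c, r, hr, hE, rfl⟩)
      · rw [Set.inter_eq_right.2 h]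
        exact .inr (.inr ⟨c', r', hr', hE', rfl⟩)
      · rw [Set.disjoint_iff_inter_eq_empty.1 h, Set.indicator_empty]
        exact .inl rfl

variable (k) in
/-- The algebra of functions generated by the indicator functions of `discSubmonoid`. -/
def discAlgebra (ρ : ℝ) (E : Set L) : Subalgebra ℤ (L → ℤ) :=
  Algebra.adjoin ℤ (discSubmonoid k ρ E : Set (L → ℤ))

open Classical in
-- The generators are closed under products, so the algebra is their `ℤ`-span. By linearity only
-- disc indicators, whose sums are root counts, and `1`, whose sum is the cardinality, need be
-- compared.
theorem sum_eq_sum_of_mem_discAlgebra {ρ : ℝ} {E : Set L} {S T : Multiset L}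
    (hcard : S.card = T.card)
    (hcount : ∀ (c : k) (r : ℝ), ρ < r → (∀ z ∈ E, ‖z - algebraMap k L c‖ ≠ r) →
      S.countP (fun z => ‖z - algebraMap k L c‖ ≤ r) =
        T.countP (fun z => ‖z - algebraMap k L c‖ ≤ r))
    {f : L → ℤ} (hf : f ∈ discAlgebra k ρ E) : (S.map f).sum = (T.map f).sum := by
  rw [discAlgebra, ← Subalgebra.mem_toSubmodule, Algebra.adjoin_eq_span,
    Submonoid.closure_eq] at hf
  induction hf using Submodule.span_induction with
  | mem f hf =>
    rcases hf with rfl | rfl | ⟨c, r, hr, hE, rfl⟩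
    · simp
    · simp [hcard]
    · have h : ∀ U : Multiset L,
          (U.map ((Metric.closedBall (algebraMap k L c) r).indicator (1 : L → ℤ))).sum =
            (U.countP (fun z => ‖z - algebraMap k L c‖ ≤ r) : ℤ) := fun U => by
        induction U using Multiset.induction_on with
        | empty => simp
        | cons z U ih =>
          rw [Multiset.map_cons, Multiset.sum_cons, Multiset.countP_cons, ih, Set.indicator_apply,
            mem_closedBall_iff_norm, add_comm]
          split_ifs <;> simp
      rw [h, h, hcount c r hr hE]
  | zero => simp
  | add f g _ _ hf hg =>
    simp only [Pi.add_apply, Multiset.sum_map_add, hf, hg]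
  | smul a f _ hf =>
    simp only [Pi.smul_apply, smul_eq_mul, Multiset.sum_map_mul_left, hf]

/-- A radius between the two distances, above `ρ` and avoiding finitely many values, gives a disc
containing just one of `x`, `y`; its indicator or the complementary one separates. Only the larger
distance has to exceed `ρ`. -/
theorem exists_mem_discAlgebra_separating {ρ : ℝ} {E : Set L} (hE : E.Finite) {x y : L} {c : k}
    (hxy : ‖x - algebraMap k L c‖ ≠ ‖y - algebraMap k L c‖)
    (hρ : ρ < ‖x - algebraMap k L c‖ ∨ ρ < ‖y - algebraMap k L c‖) :
    ∃ f ∈ discAlgebra k ρ E, f x = 1 ∧ f y = 0 ∧ 0 ≤ f := by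
  have hgen : ∀ t u : ℝ, t < u → ρ < u → ∃ r, t < r ∧ r < u ∧ ρ < r ∧
      ∀ z ∈ E, ‖z - algebraMap k L c‖ ≠ r := fun t u htu hu => by
    obtain ⟨r, ⟨hr1, hr2⟩, hr3⟩ := ((Set.Ioo_infinite (max_lt htu hu)).sdiff
      (hE.image fun z => ‖z - algebraMap k L c‖)).nonempty
    exact ⟨r, (le_max_left _ _).trans_lt hr1, hr2, (le_max_right _ _).trans_lt hr1,
      fun z hz h => hr3 ⟨z, hz, h⟩⟩
  have hmem : ∀ r, ρ < r → (∀ z ∈ E, ‖z - algebraMap k L c‖ ≠ r) →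
      (Metric.closedBall (algebraMap k L c) r).indicator 1 ∈ discAlgebra k ρ E := fun r h1 h2 =>
    Algebra.subset_adjoin (.inr (.inr ⟨c, r, h1, h2, rfl⟩))
  rcases lt_or_gt_of_ne hxy with h | h
  · obtain ⟨r, h1, h2, h3, h4⟩ := hgen _ _ h (hρ.elim (fun h' => h'.trans h) id)
    refine ⟨_, hmem r h3 h4, Set.indicator_of_mem ?_ _, Set.indicator_of_notMem ?_ _,
      Set.indicator_nonneg fun _ _ => zero_le_one⟩
    · exact mem_closedBall_iff_norm.2 h1.le
    · exact fun hy => (mem_closedBall_iff_norm.1 hy).not_gt h2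
  · obtain ⟨r, h1, h2, h3, h4⟩ := hgen _ _ h (hρ.elim id fun h' => h'.trans h)
    refine ⟨_, sub_mem (one_mem _) (hmem r h3 h4), ?_, ?_, fun z => ?_⟩
    · rw [Pi.sub_apply, Set.indicator_of_notMem, Pi.one_apply, sub_zero]
      exact fun hx => (mem_closedBall_iff_norm.1 hx).not_gt h2
    · rw [Pi.sub_apply, Set.indicator_of_mem, Pi.one_apply, sub_self]
      exact mem_closedBall_iff_norm.2 h1.le
    · rw [Pi.sub_apply, Pi.one_apply, Pi.zero_apply, sub_nonneg]
      exact Set.indicator_le_self' (fun _ _ => zero_le_one) z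

/-- Two multisets with the same sums of functions of `discAlgebra` cannot be separated by discs. -/
theorem exists_not_separated {ρ : ℝ} {E : Set L} (hE : E.Finite) {S T : Multiset L}
    (hST : ∀ f ∈ discAlgebra k ρ E, (S.map f).sum = (T.map f).sum) {x : L} (hx : x ∈ S)
    (hρ : ∀ y ∈ T, ∀ c : k, ρ < ‖x - algebraMap k L c‖ ∨ ρ < ‖y - algebraMap k L c‖) :
    ∃ y ∈ T, ∀ c : k, ‖x - algebraMap k L c‖ = ‖y - algebraMap k L c‖ := by
  by_contra! hcon
  -- Multiplying separators over the members of `T` gives a nonnegative function with sum `0` on `T`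
  -- but at least `1` on `S`.
  have hsep : ∃ f ∈ discAlgebra k ρ E, f x = 1 ∧ (∀ y ∈ T, f y = 0) ∧ 0 ≤ f := by
    clear hST
    induction T using Multiset.induction_on with
    | empty => exact ⟨1, one_mem _, rfl, by simp, fun _ => zero_le_one⟩
    | cons y T ih =>
      obtain ⟨f, hf, hfx, hfT, hf0⟩ := ih (fun y hy => hρ y (Multiset.mem_cons_of_mem hy))
        fun y hy => hcon y (Multiset.mem_cons_of_mem hy)
      obtain ⟨c, hc⟩ := hcon y (Multiset.mem_cons_self y T)
      obtain ⟨g, hg, hgx, hgy, hg0⟩ := exists_mem_discAlgebra_separating hE hc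
        (hρ y (Multiset.mem_cons_self y T) c)
      refine ⟨f * g, mul_mem hf hg, by simp [hfx, hgx], fun z hz => ?_, mul_nonneg hf0 hg0⟩
      rcases Multiset.mem_cons.1 hz with rfl | hz
      · simp [hgy]
      · simp [hfT z hz]
  obtain ⟨f, hf, hfx, hfT, hf0⟩ := hsep
  have h1 : (T.map f).sum = 0 := Multiset.sum_eq_zero fun a ha => by
    obtain ⟨y, hy, rfl⟩ := Multiset.mem_map.1 ha
    exact hfT y hy
  have h2 : f x ≤ (S.map f).sum := Multiset.single_le_sum (fun a ha => by
    obtain ⟨y, -, rfl⟩ := Multiset.mem_map.1 ha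
    exact hf0 y) _ (Multiset.mem_map_of_mem f hx)
  rw [hST f hf, h1, hfx] at h2
  exact absurd h2 (by norm_num)

end Separation

/-! ### Decomposition of differential polynomials -/

namespace DiffPoly

section Decomposition

variable {k : Type*} [NormedField k] {K : Type*} [NormedField K]
  {L : Type*} [NormedField L] [NormedAlgebra K L] [NormedAlgebra k L]

variable (k L) in
/-- The image in the line over `k` of the set of roots of `P` in `L`. -/
def rootPoints (P : K[X]) : Set (BerkovichLine k) :=
  BerkovichLine.ofElement k '' {z : L | z ∈ P.aroots L}

variable (k L) in
/-- The roots of `P` in `L` have distance greater than `ρ` to all elements of `k`. -/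
def RootsFar (ρ : ℝ) (P : K[X]) : Prop :=
  ∀ z ∈ P.aroots L, ∀ c : k, ρ < ‖z - algebraMap k L c‖

theorem finite_rootPoints (P : K[X]) : (rootPoints k L P).Finite := by
  classical
  refine Set.Finite.image _ ((P.aroots L).toFinset.finite_toSet.subset fun z hz => ?_)
  simpa using hz

theorem rootPoints_one : rootPoints k L (1 : K[X]) = ∅ := by
  simp [rootPoints]

theorem RootsFar.of_rootPoints_subset [IsAlgClosed k] {ρ : ℝ} {P Q : K[X]} (hP : RootsFar k L ρ P)
    (hQ : rootPoints k L Q ⊆ rootPoints k L P) : RootsFar k L ρ Q := fun z hz c => by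
  obtain ⟨w, hw, hwz⟩ := hQ ⟨z, hz, rfl⟩
  rw [← BerkovichLine.ofElement_eq_iff.1 hwz c]
  exact hP w hw c

theorem card_aroots_eq [IsAlgClosed L] (P : K[X]) : (P.aroots L).card = P.natDegree := by
  rw [aroots_def, ← (IsAlgClosed.splits _).natDegree_eq_card_roots, natDegree_map]

theorem eq_one_of_rootPoints_eq_empty [IsAlgClosed L] {P : K[X]} (hP : P.Monic) (h : rootPoints k L P = ∅) :
    P = 1 := by
  have h0 : P.aroots L = 0 := Multiset.eq_zero_of_forall_notMem fun z hz => by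
    have : BerkovichLine.ofElement k z ∈ rootPoints k L P := ⟨z, hz, rfl⟩
    rwa [h] at this
  refine hP.natDegree_eq_zero.1 ?_
  rw [← card_aroots_eq (L := L), h0, Multiset.card_zero]

variable [IsAlgClosed k] [IsUltrametricDist K] [NormedAlgebra k K] [IsAlgClosed L]
  [IsScalarTower k K L] {d : Derivation k K K}

/-- The points defined by the roots of a product of differential polynomials are those defined by
the roots of the factors. -/
theorem rootPoints_mulHom {ρ : ℝ} (hd : ∀ f, ‖d f‖ ≤ ρ * ‖f‖) (hρ : 0 ≤ ρ) {A B : K[X]}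
    (hA : A.Monic) (hB : B.Monic) (hAB : (mulHom d A B).Monic)
    (hfar : RootsFar k L ρ (mulHom d A B)) :
    rootPoints k L (mulHom d A B) = rootPoints k L A ∪ rootPoints k L B := by
  classical
  have : IsUltrametricDist L := .of_normedAlgebra K
  set S := (mulHom d A B).aroots L with hS
  set T := A.aroots L + B.aroots L with hT
  set E : Set L := {z | z ∈ S + T} with hE
  have hEfin : E.Finite := (S + T).toFinset.finite_toSet.subset fun z hz => by
    rw [Finset.mem_coe, Multiset.mem_toFinset]
    exact hz
  have hsum : ∀ f ∈ discAlgebra k ρ E, (S.map f).sum = (T.map f).sum := fun f hf => by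
    refine sum_eq_sum_of_mem_discAlgebra ?_ (fun c r hr hgen => ?_) hf
    · rw [hT, Multiset.card_add, hS, card_aroots_eq, card_aroots_eq, card_aroots_eq]
      -- Only degrees matter here; `ρ + 1` is a convenient positive radius above `ρ`.
      exact ((isProductDeformation (r := ρ + 1) (by positivity) hd hρ
        (by linarith)).monic_apply hA hB).2
    · rw [hT, Multiset.countP_add]
      have h := rootCount_mulHom (L := L) hd hρ hr hA hB hAB c fun z hz => by
        rw [← IsScalarTower.algebraMap_apply]
        refine hgen z ?_
        simp only [hE, hT, Multiset.mem_add, Set.mem_ofPred_eq]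
        exact hz
      simp only [rootCount, ← IsScalarTower.algebraMap_apply] at h
      exact h
  have hunion : rootPoints k L A ∪ rootPoints k L B = BerkovichLine.ofElement k '' {z | z ∈ T} := by
    simp only [hT, Multiset.mem_add, Set.ofPred_or, Set.image_union, rootPoints]
  rw [hunion]
  refine Set.Subset.antisymm ?_ ?_
  · rintro _ ⟨x, hx, rfl⟩
    -- In both inclusions the distance bound comes from roots of the product, since nothing is known
    -- yet about the roots of the factors.
    obtain ⟨y, hy, hxy⟩ := exists_not_separated hEfin hsum hx fun y _ c => .inl (hfar x hx c)
    exact ⟨y, hy, (BerkovichLine.ofElement_eq_iff.2 hxy).symm⟩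
  · rintro _ ⟨x, hx, rfl⟩
    obtain ⟨y, hy, hxy⟩ := exists_not_separated hEfin (fun f hf => (hsum f hf).symm) hx
      fun y hy c => .inr (hfar y hy c)
    exact ⟨y, hy, (BerkovichLine.ofElement_eq_iff.2 hxy).symm⟩

variable [CompleteSpace K]

/-- A circle around `c` between the two points splits `P`; its radius exceeds `ρ` because the
smaller distance already does. Using the product or its flip, according to which point is nearer,
keeps `x` on the left. -/
theorem exists_factorization_separating {ρ : ℝ} (hd : ∀ f, ‖d f‖ ≤ ρ * ‖f‖) (hρ : 0 ≤ ρ)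
    {P : K[X]} (hP : P.Monic) (hfar : RootsFar k L ρ P) {x y : BerkovichLine k}
    (hx : x ∈ rootPoints k L P) (hy : y ∈ rootPoints k L P) (hxy : x ≠ y) :
    ∃ A B : K[X], A.Monic ∧ B.Monic ∧ P = mulHom d A B ∧ x ∉ rootPoints k L B ∧
      y ∉ rootPoints k L A := by
  obtain ⟨z, hz, rfl⟩ := hx
  obtain ⟨w, hw, rfl⟩ := hy
  obtain ⟨c, hc⟩ : ∃ c : k, ‖z - algebraMap k L c‖ ≠ ‖w - algebraMap k L c‖ := by
    by_contra! h
    exact hxy (BerkovichLine.ofElement_eq_iff.2 h)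
  have hgen : ∀ t u : ℝ, t < u → ∃ r, t < r ∧ r < u ∧
      ∀ v ∈ P.aroots L, ‖v - algebraMap K L (algebraMap k K c)‖ ≠ r := fun t u htu => by
    classical
    obtain ⟨r, ⟨hr1, hr2⟩, hr3⟩ := ((Set.Ioo_infinite htu).sdiff
      ((P.aroots L).toFinset.finite_toSet.image
        fun v => ‖v - algebraMap K L (algebraMap k K c)‖)).nonempty
    exact ⟨r, hr1, hr2, fun v hv h => hr3 ⟨v, by simpa using hv, h⟩⟩
  have hlt : ∀ {Q : K[X]} {r : ℝ} {v : L},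
      (∀ u ∈ Q.aroots L, ‖u - algebraMap K L (algebraMap k K c)‖ < r) →
      r < ‖v - algebraMap k L c‖ → BerkovichLine.ofElement k v ∉ rootPoints k L Q := by
    rintro Q r v hQ hv ⟨u, hu, huv⟩
    rw [← BerkovichLine.ofElement_eq_iff.1 huv c, IsScalarTower.algebraMap_apply k K L] at hv
    exact lt_asymm hv (hQ u hu)
  have hgt : ∀ {Q : K[X]} {r : ℝ} {v : L},
      (∀ u ∈ Q.aroots L, r < ‖u - algebraMap K L (algebraMap k K c)‖) →
      ‖v - algebraMap k L c‖ < r → BerkovichLine.ofElement k v ∉ rootPoints k L Q := by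
    rintro Q r v hQ hv ⟨u, hu, huv⟩
    rw [← BerkovichLine.ofElement_eq_iff.1 huv c, IsScalarTower.algebraMap_apply k K L] at hv
    exact lt_asymm hv (hQ u hu)
  rcases lt_or_gt_of_ne hc with h | h
  · obtain ⟨r, h1, h2, h3⟩ := hgen _ _ h
    obtain ⟨A, B, hA, hB, hAB, hAr, hBr⟩ := exists_factorization_disc (L := L) hd hρ
      ((hfar z hz c).trans h1) (.inl rfl) hP c h3
    exact ⟨A, B, hA, hB, hAB, hgt hBr h1, hlt hAr h2⟩
  · obtain ⟨r, h1, h2, h3⟩ := hgen _ _ h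
    obtain ⟨A, B, hA, hB, hAB, hAr, hBr⟩ := exists_factorization_disc (L := L) hd hρ
      ((hfar w hw c).trans h1) (.inr rfl) hP c h3
    exact ⟨B, A, hB, hA, hAB, hlt hAr h2, hgt hBr h1⟩

/-- Any point defined by the roots of `P` can be split off as a left factor. -/
theorem exists_left_factor {ρ : ℝ} (hd : ∀ f, ‖d f‖ ≤ ρ * ‖f‖) (hρ : 0 ≤ ρ) (n : ℕ) :
    ∀ {P : K[X]}, P.Monic → RootsFar k L ρ P → (rootPoints k L P).ncard ≤ n →
      ∀ {x : BerkovichLine k}, x ∈ rootPoints k L P →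
      ∃ A R : K[X], A.Monic ∧ R.Monic ∧ P = mulHom d A R ∧ rootPoints k L A = {x} ∧
        rootPoints k L R = rootPoints k L P \ {x} := by
  induction n with
  | zero =>
    intro P _ _ hn x hx
    rw [Nat.le_zero, Set.ncard_eq_zero (finite_rootPoints P)] at hn
    rw [hn] at hx
    exact absurd hx (Set.notMem_empty x)
  | succ n ih =>
    intro P hP hfar hn x hx
    by_cases hsingle : rootPoints k L P = {x}
    · exact ⟨P, 1, hP, monic_one, (mulHom_one P).symm, hsingle, by
        rw [rootPoints_one, hsingle, Set.sdiff_self]⟩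
    obtain ⟨y, hy, hyx⟩ : ∃ y ∈ rootPoints k L P, y ≠ x := by
      by_contra! h
      exact hsingle (Set.eq_singleton_iff_unique_mem.2 ⟨hx, h⟩)
    obtain ⟨A, B, hA, hB, rfl, hxB, hyA⟩ := exists_factorization_separating hd hρ hP hfar hx hy
      hyx.symm
    have hPAB := rootPoints_mulHom hd hρ hA hB hP hfar
    have hAP : rootPoints k L A ⊆ rootPoints k L (mulHom d A B) :=
      hPAB ▸ Set.subset_union_left
    have hxA : x ∈ rootPoints k L A := ((Set.ext_iff.1 hPAB x).1 hx).resolve_right hxB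
    have hAn : (rootPoints k L A).ncard ≤ n := by
      have := Set.ncard_lt_ncard (hAP.ssubset_of_mem_notMem hy hyA) (finite_rootPoints _)
      omega
    -- The left factor has lost `y` but kept `x`. After splitting `x` off it, the remainder `R` is
    -- regrouped with `B` by associativity, and `B` does not involve `x`.
    obtain ⟨A', R, hA', hR, hAR, hA'x, hRx⟩ := ih hA (hfar.of_rootPoints_subset hAP) hAn hxA
    have hRB := ((isProductDeformation (r := ρ + 1) (by positivity) hd hρ
      (by linarith)).monic_apply hR hB).1
    have hassoc : mulHom d A B = mulHom d A' (mulHom d R B) := by rw [hAR, mulHom_assoc]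
    have hsub : rootPoints k L (mulHom d R B) ⊆ rootPoints k L (mulHom d A B) := by
      have h := rootPoints_mulHom (L := L) hd hρ hA' hRB (hassoc ▸ hP) (hassoc ▸ hfar)
      rw [hassoc, h]
      exact Set.subset_union_right
    refine ⟨A', mulHom d R B, hA', hRB, hassoc, hA'x, ?_⟩
    rw [rootPoints_mulHom hd hρ hR hB hRB (hfar.of_rootPoints_subset hsub), hRx, hPAB,
      Set.union_sdiff_distrib, Set.sdiff_singleton_eq_self hxB]

/-- The last point goes into the leftmost factor, and the induction continues with the right factor,
whose root points are the remaining ones. -/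
theorem exists_decomposition {ρ : ℝ} (hd : ∀ f, ‖d f‖ ≤ ρ * ‖f‖) (hρ : 0 ≤ ρ) (ν : ℕ) :
    ∀ {P : K[X]}, P.Monic → RootsFar k L ρ P → ∀ ω : Fin ν → BerkovichLine k,
      Function.Injective ω → Set.range ω = rootPoints k L P →
      ∃ Pω : Fin ν → K[X], (∀ i, (Pω i).Monic ∧ rootPoints k L (Pω i) = {ω i}) ∧
        ofPoly d P = (List.ofFn fun i => ofPoly d (Pω i)).reverse.prod := by
  induction ν with
  | zero =>
    intro P hP _ ω _ hrange
    refine ⟨fun _ => 1, fun i => i.elim0, ?_⟩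
    rw [eq_one_of_rootPoints_eq_empty hP (hrange.symm.trans (Set.range_eq_empty ω))]
    rfl
  | succ ν ih =>
    intro P hP hfar ω hω hrange
    obtain ⟨A, R, hA, hR, rfl, hAω, hRω⟩ := exists_left_factor hd hρ _ hP hfar le_rfl
      (hrange ▸ Set.mem_range_self (Fin.last ν))
    have hrange' : Set.range (fun i : Fin ν => ω i.castSucc) = rootPoints k L R := by
      rw [hRω, ← hrange]
      ext x
      simp only [Set.mem_range, Set.mem_sdiff, Set.mem_singleton_iff]
      constructor
      · rintro ⟨i, rfl⟩
        exact ⟨⟨_, rfl⟩, fun h => (Fin.castSucc_lt_last i).ne (hω h)⟩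
      · rintro ⟨⟨i, rfl⟩, hi⟩
        induction i using Fin.lastCases with
        | last => exact absurd rfl hi
        | cast i => exact ⟨i, rfl⟩
    obtain ⟨Pω, hPω, hprod⟩ := ih hR (hfar.of_rootPoints_subset (hRω ▸ Set.sdiff_subset))
      (fun i => ω i.castSucc) (hω.comp (Fin.castSucc_injective ν)) hrange'
    refine ⟨Fin.snoc Pω A, fun i => ?_, ?_⟩
    · induction i using Fin.lastCases with
      | last => simpa using ⟨hA, hAω⟩
      | cast i => simpa using hPω i
    · rw [List.ofFn_succ', List.concat_eq_append, List.reverse_concat, List.prod_cons, ofPoly_mulHom, hprod]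
      simp

end Decomposition

end DiffPoly

end

theorem mainTheorem3
    {k : Type*} [NormedField k] [CompleteSpace k] [IsUltrametricDist k] [CharZero k]
    [IsAlgClosed k]
    {Ω : Type*} [NormedField Ω] [CompleteSpace Ω] [IsUltrametricDist Ω] [NormedAlgebra k Ω]
    -- an algebraic closure of `Ω`, with the absolute value that extends the one of `Ω`
    {Ωalg : Type*} [NormedField Ωalg] [NormedAlgebra Ω Ωalg] [IsAlgClosure Ω Ωalg]
    [NormedAlgebra k Ωalg] [IsScalarTower k Ω Ωalg]
    (d : Derivation k Ω Ω) (hd : d.IsBounded)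
    (P : Polynomial Ω) (hP : P.Monic)
    (hr : ∀ z ∈ P.aroots Ωalg, d.operatorNorm < (BerkovichLine.ofElement k z).radius)
    (ν : ℕ) (ω : Fin ν → BerkovichLine k) (hω : Function.Injective ω)
    (hrange : Set.range ω = BerkovichLine.ofElement k '' {z : Ωalg | z ∈ P.aroots Ωalg})
    (hmono : Monotone fun i => (ω i).radius) :
    ∃ Pω : Fin ν → Polynomial Ω,
      (∀ i, (Pω i).Monic ∧
        BerkovichLine.ofElement k '' {z : Ωalg | z ∈ (Pω i).aroots Ωalg} = {ω i}) ∧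
      -- the product is `P_{ω_ν}(d) ⋯ P_{ω_1}(d)`, in decreasing order of the indices
      DiffPoly.ofPoly d P =
        (List.ofFn fun i => DiffPoly.ofPoly d (Pω i)).reverse.prod := by
  have := IsAlgClosure.isAlgClosed Ω (K := Ωalg)
  refine DiffPoly.exists_decomposition hd.norm_apply_le d.operatorNorm_nonneg ν hP
    (fun z hz c => (hr z hz).trans_le ?_) ω hω hrange
  -- The radius is the infimum of the distances to `k`, so the assumption bounds every distance from
  -- below.
  refine (ciInf_le ⟨0, ?_⟩ c).trans_eq ?_
  · rintro _ ⟨c, rfl⟩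
    exact apply_nonneg _ _
  · rw [BerkovichLine.ofElement_apply]
    simp
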